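/- Let $F:[0,\infty)\to[0,\infty)$ be a $C^2$ function with $F(0)=0$ and $F'>0$ on $(0,\infty)$, and put $$d_F=\sup_{t>0}\frac{tF'(t)}{F(t)},\qquad l_F=\inf_{t>0}\frac{tF'(t)}{F(t)}.$$ Let $m\ge 3$, let $\mathbb R^m$ carry the Euclidean metric, and let $(N,h)$ be a finite-dimensional smooth Riemannian manifold. Let $u:\mathbb R^m\to N$ be a $C^2$ map which is $F$-harmonic, that is, a critical point of the $F$-energy: for every compactly supported variation $u_t$ $(-\varepsilon<t<\varepsilon)$ of $u$, i.e. every family of maps $u_t:\mathbb R^m\to N$ that is jointly $C^2$ in $(t,x)$ with $u_0=u$ and $u_t=u$ outside a compact set $K$ independent of $t$, $$\frac{d}{dt}\Big|_{t=0}\int_K F\Big(\frac{|du_t|^2}{2}\Big)\,dx=0,\qquad |du|^2=\sum_{i=1}^m h\big(du(e_i),du(e_i)\big),$$ where $(e_i)$ is the standard basis of $\mathbb R^m$. Suppose that $l_F>0$, that $d_F\le 1$, and that $F'\big(\tfrac{|du|^2}{2}\big)$ is bounded on $\mathbb R^m$. If there is a point $p_0\in N$ with $u(x)\to p_0$ as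 $|x|\to\infty$, then $u$ is constant. -/

import Mathlib

open Set Filter Topology MeasureTheory Manifold Bundle
open scoped ContDiff

noncomputable section

namespace FHarmonic

/-- `F : [0, ∞) → [0, ∞)` is of class `C²` (up to the end point `0`), `F 0 = 0` and `F' > 0` on
`(0, ∞)`. The values of `F : ℝ → ℝ` at negative numbers are irrelevant. -/
structure IsProfile (F : ℝ → ℝ) : Prop where
  contDiffOn : ContDiffOn ℝ 2 F (Ici 0)
  nonneg : ∀ t, 0 ≤ t → 0 ≤ F t
  map_zero : F 0 = 0
  deriv_pos : ∀ t, 0 < t → 0 < derivWithin F (Ici 0) t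

/-- The upper degree `d_F = sup_{t > 0} t F'(t) / F(t)`, an extended real number. -/
def upperDegree (F : ℝ → ℝ) : EReal :=
  ⨆ t : Ioi (0 : ℝ), ((t * derivWithin F (Ici 0) t / F t : ℝ) : EReal)

/-- The lower degree `l_F = inf_{t > 0} t F'(t) / F(t)`, an extended real number. -/
def lowerDegree (F : ℝ → ℝ) : EReal :=
  ⨅ t : Ioi (0 : ℝ), ((t * derivWithin F (Ici 0) t / F t : ℝ) : EReal)

section Maps

variable {m n : ℕ} {N : Type*} [TopologicalSpace N]
  [ChartedSpace (EuclideanSpace ℝ (Fin n)) N] [IsManifold (𝓡 n) ∞ N]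

/-- The energy density `|du|² / 2` at `x` of a map `u` from Euclidean space to `(N, h)`, where
`|du|² = ∑ i, h(du(eᵢ), du(eᵢ))` for the standard orthonormal basis `(eᵢ)`. -/
def energyDensity
    (h : ContMDiffRiemannianMetric (𝓡 n) ∞ (EuclideanSpace ℝ (Fin n))
      (fun y : N ↦ TangentSpace (𝓡 n) y))
    (u : EuclideanSpace ℝ (Fin m) → N) (x : EuclideanSpace ℝ (Fin m)) : ℝ :=
  (∑ i : Fin m, h.inner (u x)
    (mfderiv (𝓡 m) (𝓡 n) u x (EuclideanSpace.single i (1 : ℝ)))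
    (mfderiv (𝓡 m) (𝓡 n) u x (EuclideanSpace.single i (1 : ℝ)))) / 2

/-- The `F`-energy `∫_K F(|du|² / 2) dx` of `u` over `K`. -/
def energyOn (F : ℝ → ℝ)
    (h : ContMDiffRiemannianMetric (𝓡 n) ∞ (EuclideanSpace ℝ (Fin n))
      (fun y : N ↦ TangentSpace (𝓡 n) y))
    (K : Set (EuclideanSpace ℝ (Fin m))) (u : EuclideanSpace ℝ (Fin m) → N) : ℝ :=
  ∫ x in K, F (energyDensity h u x)

/-- `U t`, `-ε < t < ε`, is a variation of `u` supported in the compact set `K`: it is jointly `C²`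
in `(t, x)`, `U 0 = u`, and `U t = u` outside `K`. -/
structure IsVariation (u : EuclideanSpace ℝ (Fin m) → N) (ε : ℝ)
    (K : Set (EuclideanSpace ℝ (Fin m))) (U : ℝ → EuclideanSpace ℝ (Fin m) → N) : Prop where
  pos : 0 < ε
  isCompact : IsCompact K
  contMDiffOn : ContMDiffOn 𝓘(ℝ, ℝ × EuclideanSpace ℝ (Fin m)) (𝓡 n) 2
    (fun p : ℝ × EuclideanSpace ℝ (Fin m) ↦ U p.1 p.2) (Ioo (-ε) ε ×ˢ univ)
  map_zero : ∀ x, U 0 x = u x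
  eq_off : ∀ t ∈ Ioo (-ε) ε, ∀ x ∉ K, U t x = u x

/-- `u` is `F`-harmonic: a critical point of the `F`-energy with respect to every compactly
supported variation. As the `F`-energy over the whole space may be infinite, it is taken over the
compact set `K` outside which the variation leaves `u` fixed. -/
def IsFHarmonic (F : ℝ → ℝ)
    (h : ContMDiffRiemannianMetric (𝓡 n) ∞ (EuclideanSpace ℝ (Fin n))
      (fun y : N ↦ TangentSpace (𝓡 n) y))
    (u : EuclideanSpace ℝ (Fin m) → N) : Prop :=
  ∀ (ε : ℝ) (K : Set (EuclideanSpace ℝ (Fin m))) (U : ℝ → EuclideanSpace ℝ (Fin m) → N),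
    IsVariation (n := n) u ε K U → HasDerivAt (fun t ↦ energyOn F h K (U t)) 0 0

end Maps

end FHarmonic

end

/-! The proof compares two estimates of the `F`-energy of `u` on the annuli `R² ≤ |x|² ≤ 2 R²`;
write `e = |du|² / 2`.

From below: varying `u` by reparametrisations of the source gives the conservation law of the
stress-energy tensor, `∫ F'(e) ⟨u^*h, ∇ξ⟩ - F(e) div ξ = 0` for compactly supported fields `ξ`
(`IsFHarmonic.integral_stressEnergy_eq_zero`). For the radial field `ξ = θ(|x|² / R²) (1 +
|x|²)^(-(m - 2) / 2) x` with a cutoff `θ`, the bound `t F'(t) ≤ F(t)`, which is `d_F ≤ 1`,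
leaves a positive weight in front of `F(e)` inside the ball of radius `R`. What the cutoff
produces lives on the annulus, whence `∫_{|x| ≤ R} w F(e) ≤ C R^(2 - m) ∫_{annulus} F(e)` for a
fixed positive weight `w` (`IsFHarmonic.exists_weighted_integral_le`). This replaces the usual
monotonicity formula for the energy of balls.

From above: far out `u` lies in a small coordinate ball around `p₀`, where it can be varied in
coordinates `v` centred at `p₀` along `(1 + t ζ²) v`. Since the radial derivative of the metric
coefficients is dominated by the metric (`exists_radius_abs_fderiv_le`), this yields the
Caccioppoli inequality `∫ F'(e) ζ² e ≤ C ∫ F'(e) |∇ζ|² |v|²`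
(`IsFHarmonic.setIntegral_cutoff_le`). With `ζ` of scale `R`, `F'(e)` bounded, `l_F F(e) ≤ e
F'(e)` and `v → 0`, the energy of the annulus is `o(R^(m - 2))`
(`IsFHarmonic.exists_annulus_integral_le`).

Letting `R → ∞`, the weighted energy vanishes, hence `du = 0`, and `u` is constant because
Euclidean space is connected.
-/

namespace FHarmonic

/-! ### Extension of the profile and differentiation under the integral -/

/-- The profile extends to a `C¹` function on the whole line. As energy densities are nonnegative,
the extension may replace `F` everywhere, and two-sided derivatives become available where the
energy density vanishes. -/
theorem IsProfile.exists_contDiff_extension {F : ℝ → ℝ} (hF : IsProfile F) :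
    ∃ Φ : ℝ → ℝ, ContDiff ℝ 1 Φ ∧
      ∀ t, 0 ≤ t → Φ t = F t ∧ deriv Φ t = derivWithin F (Ici 0) t := by
  -- extend `F'` by the constant `F' 0` to the left of `0` and integrate
  set f : ℝ → ℝ := fun t ↦ derivWithin F (Ici 0) (max t 0) with hf
  have hc : ContinuousOn (derivWithin F (Ici 0)) (Ici 0) :=
    hF.contDiffOn.continuousOn_derivWithin (uniqueDiffOn_Ici 0) (by norm_num)
  have hfc : Continuous f :=
    hc.comp_continuous (by fun_prop) (fun t ↦ le_max_right t 0)
  have hd : ∀ t, HasDerivAt (fun t ↦ ∫ s in (0 : ℝ)..t, f s) (f t) t := fun t ↦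
    intervalIntegral.integral_hasDerivAt_right (hfc.intervalIntegrable _ _)
      hfc.aestronglyMeasurable.stronglyMeasurableAtFilter hfc.continuousAt
  refine ⟨fun t ↦ ∫ s in (0 : ℝ)..t, f s, ?_, fun t ht ↦ ⟨?_, ?_⟩⟩
  · rw [contDiff_one_iff_deriv]
    refine ⟨fun t ↦ (hd t).differentiableAt, ?_⟩
    have : deriv (fun t ↦ ∫ s in (0 : ℝ)..t, f s) = f := funext fun t ↦ (hd t).deriv
    rwa [this]
  · have := intervalIntegral.integral_eq_sub_of_hasDerivAt_of_le ht
      (f := F) (f' := f) (hF.contDiffOn.continuousOn.mono Icc_subset_Ici_self) ?_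
      (hfc.intervalIntegrable _ _)
    · simpa [hF.map_zero] using this
    · intro x hx
      have h1 : DifferentiableWithinAt ℝ F (Ici 0) x :=
        (hF.contDiffOn.differentiableOn (by norm_num)) x hx.1.le
      have h2 := h1.hasDerivWithinAt.hasDerivAt (Ici_mem_nhds hx.1)
      simpa [hf, max_eq_left hx.1.le] using h2
  · rw [(hd t).deriv]
    simp [hf, max_eq_left ht]

/-- Differentiation under the integral sign over a compact set, for an integrand which is `C¹` near
it; the derivative `D` of the integrand is then integrable. -/
theorem hasDerivAt_setIntegral_of_contDiffOn {E : Type*} [NormedAddCommGroup E] [NormedSpace ℝ E]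
    [FiniteDimensional ℝ E] [MeasurableSpace E] [BorelSpace E] {μ : Measure E}
    [IsFiniteMeasureOnCompacts μ] {ε : ℝ} (hε : 0 < ε) {K O : Set E} (hK : IsCompact K)
    (hO : IsOpen O) (hKO : K ⊆ O) {G : ℝ × E → ℝ}
    (hG : ContDiffOn ℝ 1 G (Ioo (-ε) ε ×ˢ O)) {D : E → ℝ}
    (hD : ∀ x ∈ K, HasDerivAt (fun t ↦ G (t, x)) (D x) 0) :
    IntegrableOn D K μ ∧
      HasDerivAt (fun t ↦ ∫ x in K, G (t, x) ∂μ) (∫ x in K, D x ∂μ) 0 := by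
  have hopen : IsOpen (Ioo (-ε) ε ×ˢ O) := isOpen_Ioo.prod hO
  set G' : ℝ × E → ℝ := fun p ↦ fderiv ℝ G p (1, 0) with hG'
  have hG'c : ContinuousOn G' (Ioo (-ε) ε ×ˢ O) :=
    (hG.continuousOn_fderiv_of_isOpen hopen le_rfl).clm_apply continuousOn_const
  have hder : ∀ t ∈ Ioo (-ε) ε, ∀ x ∈ K, HasDerivAt (fun t ↦ G (t, x)) (G' (t, x)) t := by
    intro t ht x hx
    have h1 : HasFDerivAt G (fderiv ℝ G (t, x)) (t, x) :=
      ((hG.differentiableOn one_ne_zero).differentiableAt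
        (hopen.mem_nhds ⟨ht, hKO hx⟩)).hasFDerivAt
    have h2 : HasDerivAt (fun t : ℝ ↦ (t, x)) ((1 : ℝ), (0 : E)) t :=
      (hasDerivAt_id t).prodMk (hasDerivAt_const t x)
    exact h1.comp_hasDerivAt t h2
  have hDG : EqOn D (fun x ↦ G' (0, x)) K := fun x hx ↦
    (hD x hx).unique (hder 0 (by simp [hε]) x hx)
  rw [setIntegral_congr_fun hK.measurableSet hDG, integrableOn_congr_fun hDG hK.measurableSet]
  have hsub : Icc (-(ε / 2)) (ε / 2) ⊆ Ioo (-ε) ε := fun t ht ↦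
    ⟨by linarith [ht.1], by linarith [ht.2]⟩
  obtain ⟨C, hC⟩ :=
    ((isCompact_Icc (a := -(ε / 2)) (b := ε / 2)).prod hK).exists_bound_of_continuousOn
      (hG'c.mono (prod_mono hsub hKO))
  have hslice : ∀ t ∈ Icc (-(ε / 2)) (ε / 2), ContinuousOn (fun x ↦ G (t, x)) K := fun t ht ↦
    hG.continuousOn.comp (by fun_prop) fun x hx ↦ ⟨hsub ht, hKO hx⟩
  have hslice' : ContinuousOn (fun x ↦ G' (0, x)) K :=
    hG'c.comp (by fun_prop) fun x hx ↦ ⟨by simp [hε], hKO hx⟩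
  have hnhds : Icc (-(ε / 2)) (ε / 2) ∈ 𝓝 (0 : ℝ) := Icc_mem_nhds (by linarith) (by linarith)
  refine (hasDerivAt_integral_of_dominated_loc_of_deriv_le (F := fun t x ↦ G (t, x))
    (F' := fun t x ↦ G' (t, x)) (bound := fun _ ↦ C) hnhds ?_ ?_ ?_ ?_ ?_ ?_)
  · filter_upwards [hnhds] with t ht
    exact (hslice t ht).aestronglyMeasurable_of_isCompact hK hK.measurableSet
  · exact (hslice 0 (mem_of_mem_nhds hnhds)).integrableOn_compact hK
  · exact hslice'.aestronglyMeasurable_of_isCompact hK hK.measurableSet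
  · filter_upwards [ae_restrict_mem hK.measurableSet] with x hx t ht
    exact hC (t, x) ⟨ht, hx⟩
  · exact continuousOn_const.integrableOn_compact hK
  · filter_upwards [ae_restrict_mem hK.measurableSet] with x hx t ht
    exact hder t (hsub ht) x hx

/-! ### The pullback of the target metric -/

section Pullback

variable {k n : ℕ} {N : Type*} [TopologicalSpace N]
  [ChartedSpace (EuclideanSpace ℝ (Fin n)) N] [IsManifold (𝓡 n) ∞ N]

/-- The pullback `f^* h` of the metric of the target, a field of bilinear forms on the Euclidean
source. -/
noncomputable def pullbackMetric
    (h : ContMDiffRiemannianMetric (𝓡 n) ∞ (EuclideanSpace ℝ (Fin n))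
      (fun y : N ↦ TangentSpace (𝓡 n) y))
    (f : EuclideanSpace ℝ (Fin k) → N) (x : EuclideanSpace ℝ (Fin k)) :
    EuclideanSpace ℝ (Fin k) →L[ℝ] EuclideanSpace ℝ (Fin k) →L[ℝ] ℝ :=
  letI A : EuclideanSpace ℝ (Fin k) →L[ℝ] EuclideanSpace ℝ (Fin n) := mfderiv (𝓡 k) (𝓡 n) f x
  letI B : EuclideanSpace ℝ (Fin n) →L[ℝ] EuclideanSpace ℝ (Fin n) →L[ℝ] ℝ := h.inner (f x)
  B.bilinearComp A A

variable (h : ContMDiffRiemannianMetric (𝓡 n) ∞ (EuclideanSpace ℝ (Fin n))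
      (fun y : N ↦ TangentSpace (𝓡 n) y)) (f : EuclideanSpace ℝ (Fin k) → N)

theorem pullbackMetric_apply (x a b : EuclideanSpace ℝ (Fin k)) :
    pullbackMetric h f x a b =
      h.inner (f x) (mfderiv (𝓡 k) (𝓡 n) f x a) (mfderiv (𝓡 k) (𝓡 n) f x b) := rfl

theorem pullbackMetric_symm (x a b : EuclideanSpace ℝ (Fin k)) :
    pullbackMetric h f x a b = pullbackMetric h f x b a :=
  h.symm _ _ _

theorem pullbackMetric_self_nonneg (x a : EuclideanSpace ℝ (Fin k)) :
    0 ≤ pullbackMetric h f x a a := by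
  rw [pullbackMetric_apply]
  by_cases hz : mfderiv (𝓡 k) (𝓡 n) f x a = 0
  · rw [hz]; simp
  · exact (h.pos _ _ hz).le

theorem energyDensity_eq (x : EuclideanSpace ℝ (Fin k)) :
    energyDensity h f x = (∑ i : Fin k, pullbackMetric h f x
      (EuclideanSpace.single i 1) (EuclideanSpace.single i 1)) / 2 := rfl

theorem energyDensity_nonneg (x : EuclideanSpace ℝ (Fin k)) : 0 ≤ energyDensity h f x := by
  rw [energyDensity_eq]
  exact div_nonneg (Finset.sum_nonneg fun i _ ↦ pullbackMetric_self_nonneg h f x _) zero_le_two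

/-- The pullback of a smooth metric by a `C²` map is `C¹`. It is used for `u` itself and for the
inverse of a chart, where it gives the coefficients of the metric in coordinates. -/
theorem contDiffOn_pullbackMetric {f : EuclideanSpace ℝ (Fin k) → N}
    {S : Set (EuclideanSpace ℝ (Fin k))} (hS : IsOpen S) (hf : ContMDiffOn (𝓡 k) (𝓡 n) 2 f S) :
    ContDiffOn ℝ 1 (pullbackMetric h f) S := by
  -- the field `df(a)` along `f` is the tangent map of `f` composed with a constant section
  have key : ∀ a : EuclideanSpace ℝ (Fin k), ContMDiffOn (𝓡 k) ((𝓡 n).prod (𝓡 n)) 1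
      (fun x ↦ (TotalSpace.mk' (EuclideanSpace ℝ (Fin n)) (f x) (mfderiv (𝓡 k) (𝓡 n) f x a) :
        TangentBundle (𝓡 n) N)) S := by
    intro a
    have h1 := hf.contMDiffOn_tangentMapWithin (m := 1) (by norm_num) hS.uniqueMDiffOn
    have h2 : ContMDiffOn (𝓡 k) ((𝓡 k).prod (𝓡 k)) 1
      (fun x ↦ (TotalSpace.mk' (EuclideanSpace ℝ (Fin k)) x a :
        TangentBundle (𝓡 k) (EuclideanSpace ℝ (Fin k)))) S :=
      contMDiffOn_vectorSpace_iff_contDiffOn.2 contDiffOn_const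
    refine (h1.comp h2 (fun x hx ↦ hx)).congr fun x hx ↦ ?_
    simp only [Function.comp, tangentMapWithin]
    rw [mfderivWithin_of_isOpen hS hx]
  rw [contDiffOn_clm_apply]
  intro a
  rw [contDiffOn_clm_apply]
  intro b
  rw [← contMDiffOn_iff_contDiffOn]
  have hin :=
    (h.contMDiff.of_le (m := 1) (by exact_mod_cast le_top)).comp_contMDiffOn
      (hf.of_le (by norm_num))
  have : ContMDiffOn (𝓡 k) ((𝓡 n).prod 𝓘(ℝ, ℝ)) 1
      (fun x ↦ TotalSpace.mk' ℝ (E := Bundle.Trivial N ℝ) (f x)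
        (h.inner (f x) (mfderiv (𝓡 k) (𝓡 n) f x a) (mfderiv (𝓡 k) (𝓡 n) f x b))) S :=
    ContMDiffOn.clm_bundle_apply₂ (F₁ := EuclideanSpace ℝ (Fin n))
      (F₂ := EuclideanSpace ℝ (Fin n)) hin (key a) (key b)
  intro x hx
  have h3 := this x hx
  rw [contMDiffWithinAt_totalSpace] at h3
  exact h3.2

end Pullback

/-! ### First variation formulas -/

theorem sum_coord_smul_single {m : ℕ} (x : EuclideanSpace ℝ (Fin m)) :
    ∑ i, x i • EuclideanSpace.single i (1 : ℝ) = x := by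
  simpa using (EuclideanSpace.basisFun (Fin m) ℝ).sum_repr x

/-- The divergence theorem for the product of a function and a compactly supported field. -/
theorem integral_fderiv_apply_eq_neg_integral_mul_divergence {m : ℕ}
    {f : EuclideanSpace ℝ (Fin m) → ℝ} (hf : ContDiff ℝ 1 f)
    {ξ : EuclideanSpace ℝ (Fin m) → EuclideanSpace ℝ (Fin m)} (hξ : ContDiff ℝ 1 ξ)
    (hc : HasCompactSupport ξ) :
    ∫ x, fderiv ℝ f x (ξ x) =
      -∫ x, f x * ∑ i, (fderiv ℝ ξ x (EuclideanSpace.single i 1)) i := by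
  have hfd : Continuous (fderiv ℝ f) := hf.continuous_fderiv one_ne_zero
  have hξd : Continuous (fderiv ℝ ξ) := hξ.continuous_fderiv one_ne_zero
  have hcoord : ∀ i, ContDiff ℝ 1 (fun x ↦ ξ x i) := fun i ↦ by fun_prop
  have hcs : ∀ i, HasCompactSupport (fun x ↦ ξ x i) := fun i ↦
    hc.comp_left (g := fun y : EuclideanSpace ℝ (Fin m) ↦ y i) rfl
  have hfc := hf.continuous
  have hξc := hξ.continuous
  have hdi : ∀ i x v, fderiv ℝ (fun x ↦ ξ x i) x v = (fderiv ℝ ξ x v) i := by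
    intro i x v
    have h1 := (hξ.differentiable one_ne_zero x).hasFDerivAt
    have h2 := ((EuclideanSpace.proj i : EuclideanSpace ℝ (Fin m) →L[ℝ] ℝ).hasFDerivAt
      (x := ξ x)).comp x h1
    exact congrArg (fun L ↦ L v) h2.fderiv
  have hcd : ∀ i, HasCompactSupport
      (fun x ↦ fderiv ℝ (fun x ↦ ξ x i) x (EuclideanSpace.single i 1)) := fun i ↦
    (hcs i).fderiv_apply ℝ _
  have hI1 : ∀ i, Integrable (fun x ↦ fderiv ℝ f x (EuclideanSpace.single i 1) * ξ x i) :=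
    fun i ↦ Continuous.integrable_of_hasCompactSupport (by fun_prop) ((hcs i).mul_left)
  have hI2 : ∀ i, Integrable
      (fun x ↦ f x * fderiv ℝ (fun x ↦ ξ x i) x (EuclideanSpace.single i 1)) := fun i ↦
    Continuous.integrable_of_hasCompactSupport
      (hfc.mul (((hcoord i).continuous_fderiv one_ne_zero).clm_apply continuous_const))
      ((hcd i).mul_left)
  have hI3 : ∀ i, Integrable (fun x ↦ f x * ξ x i) := fun i ↦
    Continuous.integrable_of_hasCompactSupport (by fun_prop) ((hcs i).mul_left)
  have hparts : ∀ i, ∫ x, f x * fderiv ℝ (fun x ↦ ξ x i) x (EuclideanSpace.single i 1) =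
      -∫ x, fderiv ℝ f x (EuclideanSpace.single i 1) * ξ x i := fun i ↦
    integral_mul_fderiv_eq_neg_fderiv_mul_of_integrable (hI1 i) (hI2 i) (hI3 i)
      (fun x _ ↦ hf.differentiable one_ne_zero x)
      (fun x _ ↦ (hcoord i).differentiable one_ne_zero x)
  have hexp : ∀ x, fderiv ℝ f x (ξ x) =
      ∑ i, fderiv ℝ f x (EuclideanSpace.single i 1) * ξ x i := by
    intro x
    conv_lhs => rw [← sum_coord_smul_single (ξ x)]
    simp [map_sum, mul_comm]
  simp_rw [hexp, Finset.mul_sum, ← hdi]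
  rw [integral_finsetSum _ fun i _ ↦ hI1 i, integral_finsetSum _ fun i _ ↦ hI2 i,
    ← Finset.sum_neg_distrib]
  exact Finset.sum_congr rfl fun i _ ↦ by rw [hparts i, neg_neg]

set_option maxSynthPendingDepth 3 in
/-- The `t`-derivative of an energy density `½ ∑ᵢ g(bᵢ, bᵢ)` whose base point `y` and vectors `bᵢ`
depend on `t`. -/
theorem hasDerivAt_half_sum_apply_apply {E ι : Type*} [NormedAddCommGroup E] [NormedSpace ℝ E]
    [Fintype ι] {g : E → E →L[ℝ] E →L[ℝ] ℝ} {y : ℝ → E} {x y' : E} {t : ℝ} (hx : y t = x)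
    (hg : DifferentiableAt ℝ g x) (hsymm : ∀ v w, g x v w = g x w v)
    (hy : HasDerivAt y y' t) {b : ι → ℝ → E} {b' : ι → E}
    (hb : ∀ i, HasDerivAt (b i) (b' i) t) :
    HasDerivAt (fun s ↦ (∑ i, g (y s) (b i s) (b i s)) / 2)
      (∑ i, (g x (b' i) (b i t) + fderiv ℝ g x y' (b i t) (b i t) / 2)) t := by
  subst hx
  have h1 := HasFDerivAt.comp_hasDerivAt (E := E →L[ℝ] E →L[ℝ] ℝ) (F := E) t hg.hasFDerivAt hy
  have h3 := (HasDerivAt.fun_sum fun i (_ : i ∈ Finset.univ) ↦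
    (h1.clm_apply (hb i)).clm_apply (hb i)).div_const 2
  refine h3.congr_deriv ?_
  rw [Finset.sum_div]
  refine Finset.sum_congr rfl fun i _ ↦ ?_
  simp only [Function.comp, add_apply]
  rw [hsymm (b i t)]
  ring

section

variable {k m n : ℕ} {N : Type*} [TopologicalSpace N]
  [ChartedSpace (EuclideanSpace ℝ (Fin n)) N] [IsManifold (𝓡 n) ∞ N]
  (h : ContMDiffRiemannianMetric (𝓡 n) ∞ (EuclideanSpace ℝ (Fin n))
      (fun y : N ↦ TangentSpace (𝓡 n) y))

theorem pullbackMetric_congr {f f' : EuclideanSpace ℝ (Fin k) → N} {x : EuclideanSpace ℝ (Fin k)}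
    (hff : f =ᶠ[𝓝 x] f') : pullbackMetric h f x = pullbackMetric h f' x := by
  have h1 := hff.mfderiv_eq (I := 𝓡 k) (I' := 𝓡 n)
  have h2 := hff.eq_of_nhds
  unfold pullbackMetric
  rw [h1, h2]

theorem pullbackMetric_comp {f : EuclideanSpace ℝ (Fin k) → N}
    {ψ : EuclideanSpace ℝ (Fin m) → EuclideanSpace ℝ (Fin k)} {x : EuclideanSpace ℝ (Fin m)}
    (hf : MDifferentiableAt (𝓡 k) (𝓡 n) f (ψ x)) (hψ : DifferentiableAt ℝ ψ x)
    (a b : EuclideanSpace ℝ (Fin m)) :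
    pullbackMetric h (fun y ↦ f (ψ y)) x a b =
      pullbackMetric h f (ψ x) (fderiv ℝ ψ x a) (fderiv ℝ ψ x b) := by
  have h1 : mfderiv (𝓡 m) (𝓡 n) (fun y ↦ f (ψ y)) x = _ :=
    mfderiv_comp x hf hψ.mdifferentiableAt
  have h2 : mfderiv (𝓡 m) (𝓡 k) ψ x = fderiv ℝ ψ x := mfderiv_eq_fderiv
  rw [pullbackMetric_apply, h1, h2]
  rfl

variable {h}

theorem contDiffOn_energyDensity {u : EuclideanSpace ℝ (Fin m) → N}
    {S : Set (EuclideanSpace ℝ (Fin m))} (hS : IsOpen S) (hu : ContMDiffOn (𝓡 m) (𝓡 n) 2 u S) :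
    ContDiffOn ℝ 1 (energyDensity h u) S := by
  have hg := contDiffOn_pullbackMetric h hS hu
  have : energyDensity h u = fun x ↦ (∑ i : Fin m, pullbackMetric h u x
      (EuclideanSpace.single i 1) (EuclideanSpace.single i 1)) / 2 :=
    funext fun x ↦ energyDensity_eq h u x
  rw [this]
  refine ContDiffOn.div_const (ContDiffOn.sum fun i _ ↦ ?_) 2
  exact (hg.clm_apply contDiffOn_const).clm_apply contDiffOn_const

/-- The first variation formula, for a variation along which the energy density is `C¹` near the
support. -/
theorem IsFHarmonic.setIntegral_deriv_eq_zero {F : ℝ → ℝ} (hF : IsProfile F)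
    {u : EuclideanSpace ℝ (Fin m) → N} (hharm : IsFHarmonic F h u) {ε : ℝ}
    {K O : Set (EuclideanSpace ℝ (Fin m))} {U : ℝ → EuclideanSpace ℝ (Fin m) → N}
    (hU : IsVariation (n := n) u ε K U) (hO : IsOpen O) (hKO : K ⊆ O)
    (hG : ContDiffOn ℝ 1 (fun p : ℝ × EuclideanSpace ℝ (Fin m) ↦ energyDensity h (U p.1) p.2)
      (Ioo (-ε) ε ×ˢ O))
    {D : EuclideanSpace ℝ (Fin m) → ℝ}
    (hD : ∀ x ∈ K, HasDerivAt (fun t ↦ energyDensity h (U t) x) (D x) 0) :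
    IntegrableOn (fun x ↦ derivWithin F (Ici 0) (energyDensity h u x) * D x) K ∧
      ∫ x in K, derivWithin F (Ici 0) (energyDensity h u x) * D x = 0 := by
  obtain ⟨Φ, hΦ, hΦF⟩ := hF.exists_contDiff_extension
  have hU0 : U 0 = u := funext hU.map_zero
  have h1 := hasDerivAt_setIntegral_of_contDiffOn (μ := volume) hU.pos hU.isCompact hO hKO
    (hΦ.comp_contDiffOn hG)
    (D := fun x ↦ derivWithin F (Ici 0) (energyDensity h u x) * D x) ?_
  · have h2 : HasDerivAt (fun t ↦ energyOn F h K (U t)) 0 0 := hharm ε K U hU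
    have h3 : (fun t ↦ energyOn F h K (U t)) = fun t ↦ ∫ x in K,
        (Φ ∘ fun p : ℝ × EuclideanSpace ℝ (Fin m) ↦ energyDensity h (U p.1) p.2) (t, x) := by
      funext t
      exact integral_congr_ae <| .of_forall fun x ↦
        (hΦF _ (energyDensity_nonneg h (U t) x)).1.symm
    rw [h3] at h2
    exact ⟨h1.1, h1.2.unique h2⟩
  · intro x hx
    have h4 : HasDerivAt Φ (deriv Φ (energyDensity h (U 0) x)) (energyDensity h (U 0) x) :=
      (hΦ.differentiable one_ne_zero _).hasDerivAt
    have h5 := h4.comp (0 : ℝ) (hD x hx)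
    rw [(hΦF _ (energyDensity_nonneg h _ x)).2, hU0] at h5
    exact h5

/-- Conservation of the stress-energy tensor, tested with a compactly supported vector field `ξ`:
the first variation along `u (x + t ξ(x))`. These are variations of `u` whether or not
`x ↦ x + t ξ(x)` is a diffeomorphism. The derivative of the energy density along `ξ` is removed by
the divergence theorem. -/
theorem IsFHarmonic.integral_stressEnergy_eq_zero {F : ℝ → ℝ} (hF : IsProfile F)
    {u : EuclideanSpace ℝ (Fin m) → N} (hu : ContMDiff (𝓡 m) (𝓡 n) 2 u)
    (hharm : IsFHarmonic F h u)
    {ξ : EuclideanSpace ℝ (Fin m) → EuclideanSpace ℝ (Fin m)} (hξ : ContDiff ℝ 2 ξ)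
    (hc : HasCompactSupport ξ) :
    Integrable (fun x ↦ derivWithin F (Ici 0) (energyDensity h u x) *
        ∑ i, pullbackMetric h u x (fderiv ℝ ξ x (EuclideanSpace.single i 1))
          (EuclideanSpace.single i 1) -
      F (energyDensity h u x) * ∑ i, (fderiv ℝ ξ x (EuclideanSpace.single i 1)) i) ∧
    ∫ x, (derivWithin F (Ici 0) (energyDensity h u x) *
        ∑ i, pullbackMetric h u x (fderiv ℝ ξ x (EuclideanSpace.single i 1))
          (EuclideanSpace.single i 1) -
      F (energyDensity h u x) * ∑ i, (fderiv ℝ ξ x (EuclideanSpace.single i 1)) i) = 0 := by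
  obtain ⟨Φ, hΦ, hΦF⟩ := hF.exists_contDiff_extension
  have hg : ContDiff ℝ 1 (pullbackMetric h u) := by
    rw [← contDiffOn_univ]; exact contDiffOn_pullbackMetric h isOpen_univ hu.contMDiffOn
  have he : ContDiff ℝ 1 (energyDensity h u) := by
    rw [← contDiffOn_univ]; exact contDiffOn_energyDensity isOpen_univ hu.contMDiffOn
  have hξ1 : ContDiff ℝ 1 ξ := hξ.of_le (by norm_num)
  have hξd : ContDiff ℝ 1 (fderiv ℝ ξ) := hξ.fderiv_right (by norm_num)
  have hdiff : ∀ (t : ℝ) x, HasFDerivAt (fun x ↦ x + t • ξ x)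
      (ContinuousLinearMap.id ℝ _ + t • fderiv ℝ ξ x) x := fun t x ↦
    (hasFDerivAt_id x).add (((hξ1.differentiable one_ne_zero x).hasFDerivAt).const_smul t)
  have hform : ∀ (t : ℝ) x, energyDensity h (fun x ↦ u (x + t • ξ x)) x =
      (∑ i : Fin m, pullbackMetric h u (x + t • ξ x)
        (EuclideanSpace.single i 1 + t • fderiv ℝ ξ x (EuclideanSpace.single i 1))
        (EuclideanSpace.single i 1 + t • fderiv ℝ ξ x (EuclideanSpace.single i 1))) / 2 := by
    intro t x
    rw [energyDensity_eq]
    congr 1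
    refine Finset.sum_congr rfl fun i _ ↦ ?_
    rw [pullbackMetric_comp h (f := u) (ψ := fun x ↦ x + t • ξ x)
      (hu.mdifferentiable (by norm_num) _) (hdiff t x).differentiableAt, (hdiff t x).fderiv]
    rfl
  have hU : IsVariation (n := n) u 1 (tsupport ξ) (fun t x ↦ u (x + t • ξ x)) := by
    refine ⟨one_pos, hc, ?_, fun x ↦ by simp, fun t _ x hx ↦ by
      simp [image_eq_zero_of_notMem_tsupport hx]⟩
    refine ContMDiff.contMDiffOn (hu.comp ?_)
    rw [contMDiff_iff_contDiff]
    fun_prop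
  set D : EuclideanSpace ℝ (Fin m) → ℝ := fun x ↦
    (∑ i, pullbackMetric h u x (fderiv ℝ ξ x (EuclideanSpace.single i 1))
          (EuclideanSpace.single i 1)) + fderiv ℝ (energyDensity h u) x (ξ x) with hDdef
  have hgd : ∀ x, DifferentiableAt ℝ (pullbackMetric h u) x := hg.differentiable one_ne_zero
  have hline : ∀ x v : EuclideanSpace ℝ (Fin m), HasDerivAt (fun t : ℝ ↦ x + t • v) v 0 :=
    fun x v ↦ by simpa using ((hasDerivAt_id (0 : ℝ)).smul_const v).const_add x
  have hed : ∀ x v, fderiv ℝ (energyDensity h u) x v = ∑ i : Fin m,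
      fderiv ℝ (pullbackMetric h u) x v (EuclideanSpace.single i 1)
        (EuclideanSpace.single i 1) / 2 := by
    intro x v
    have h1 := hasDerivAt_half_sum_apply_apply (by simp) (hgd x) (pullbackMetric_symm h u x)
      (hline x v) (fun i : Fin m ↦ hasDerivAt_const (0 : ℝ) (EuclideanSpace.single i (1 : ℝ)))
    have h2 : HasFDerivAt (energyDensity h u) (fderiv ℝ (energyDensity h u) x)
        (x + (0 : ℝ) • v) := by
      simpa using (he.differentiable one_ne_zero x).hasFDerivAt
    have h3 : HasDerivAt (fun t : ℝ ↦ energyDensity h u (x + t • v))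
        (fderiv ℝ (energyDensity h u) x v) 0 :=
      HasFDerivAt.comp_hasDerivAt (l := energyDensity h u) (0 : ℝ) h2 (hline x v)
    simp_rw [energyDensity_eq] at h3
    simpa [energyDensity_eq] using h3.unique h1
  have hD : ∀ x ∈ tsupport ξ, HasDerivAt
      (fun t : ℝ ↦ energyDensity h (fun x ↦ u (x + t • ξ x)) x) (D x) 0 := by
    intro x _
    simp_rw [hform]
    refine (hasDerivAt_half_sum_apply_apply (by simp) (hgd x) (pullbackMetric_symm h u x)
      (hline x (ξ x)) (fun i : Fin m ↦ hline _ _)).congr_deriv ?_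
    simp [hDdef, hed, Finset.sum_add_distrib]
  have hvar := hharm.setIntegral_deriv_eq_zero hF hU isOpen_univ (subset_univ _) (D := D) ?_ hD
  · replace hvar := hvar.2
    rw [setIntegral_eq_integral_of_forall_compl_eq_zero] at hvar
    · have hparts := integral_fderiv_apply_eq_neg_integral_mul_divergence (hΦ.comp he) hξ1 hc
      have hΦe : ∀ x, fderiv ℝ (Φ ∘ energyDensity h u) x (ξ x) =
          derivWithin F (Ici 0) (energyDensity h u x) * fderiv ℝ (energyDensity h u) x (ξ x) := by
        intro x
        rw [fderiv_comp x (hΦ.differentiable one_ne_zero _) (he.differentiable one_ne_zero x)]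
        rw [← (hΦF _ (energyDensity_nonneg h u x)).2]
        simp [mul_comm]
      have hfc : Continuous fun x ↦ derivWithin F (Ici 0) (energyDensity h u x) := by
        have : (fun x ↦ derivWithin F (Ici 0) (energyDensity h u x)) =
            fun x ↦ deriv Φ (energyDensity h u x) :=
          funext fun x ↦ (hΦF _ (energyDensity_nonneg h u x)).2.symm
        rw [this]
        exact (hΦ.continuous_deriv le_rfl).comp he.continuous
      have hcd : HasCompactSupport (fderiv ℝ ξ) := hc.fderiv ℝ
      have hξdc := hξd.continuous
      have hgc := hg.continuous
      have hI1 : Integrable fun x ↦ derivWithin F (Ici 0) (energyDensity h u x) *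
          ∑ i, pullbackMetric h u x (fderiv ℝ ξ x (EuclideanSpace.single i 1))
            (EuclideanSpace.single i 1) := by
        refine Continuous.integrable_of_hasCompactSupport (by fun_prop) (hcd.mono' ?_)
        refine fun x hx ↦ subset_tsupport _ fun h0 ↦ hx ?_
        simp [h0]
      have hI2 : Integrable fun x ↦ derivWithin F (Ici 0) (energyDensity h u x) *
          fderiv ℝ (energyDensity h u) x (ξ x) := by
        have := hξ.continuous
        have := he.continuous_fderiv one_ne_zero
        refine Continuous.integrable_of_hasCompactSupport (by fun_prop) (hc.mono' ?_)
        refine fun x hx ↦ subset_tsupport _ fun h0 ↦ hx ?_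
        simp [h0]
      have hI3 : Integrable fun x ↦ F (energyDensity h u x) *
          ∑ i, (fderiv ℝ ξ x (EuclideanSpace.single i 1)) i := by
        have h1 : (fun x ↦ F (energyDensity h u x)) = Φ ∘ energyDensity h u :=
          funext fun x ↦ (hΦF _ (energyDensity_nonneg h u x)).1.symm
        have h2 : Continuous fun x ↦ F (energyDensity h u x) := by
          rw [h1]; exact (hΦ.comp he).continuous
        refine Continuous.integrable_of_hasCompactSupport
          (h2.mul (continuous_finsetSum _ fun i _ ↦ by fun_prop)) (hcd.mono' ?_)
        refine fun x hx ↦ subset_tsupport _ fun h0 ↦ hx ?_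
        simp [h0]
      simp only [hDdef, mul_add] at hvar
      rw [integral_add hI1 hI2] at hvar
      simp_rw [hΦe] at hparts
      refine ⟨hI1.sub hI3, ?_⟩
      rw [integral_sub hI1 hI3]
      have h4 : ∀ x, (Φ ∘ energyDensity h u) x = F (energyDensity h u x) := fun x ↦
        (hΦF _ (energyDensity_nonneg h u x)).1
      simp_rw [h4] at hparts
      linarith
    · intro x hx
      have h0 : fderiv ℝ ξ x = 0 := by
        by_contra hne
        exact hx (tsupport_fderiv_subset ℝ (subset_tsupport _ hne))
      simp [hDdef, h0, image_eq_zero_of_notMem_tsupport hx]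
  · simp_rw [hform]
    refine ContDiff.contDiffOn ?_
    refine ContDiff.div_const (ContDiff.sum fun i _ ↦ ?_) 2
    have h1 : ContDiff ℝ 1 (fun p : ℝ × EuclideanSpace ℝ (Fin m) ↦ p.2 + p.1 • ξ p.2) := by
      fun_prop
    have h2 : ContDiff ℝ 1 (fun p : ℝ × EuclideanSpace ℝ (Fin m) ↦
        fderiv ℝ ξ p.2 (EuclideanSpace.single i 1)) :=
      (hξd.comp contDiff_snd).clm_apply contDiff_const
    have h3 : ContDiff ℝ 1 (fun p : ℝ × EuclideanSpace ℝ (Fin m) ↦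
        EuclideanSpace.single i 1 + p.1 • fderiv ℝ ξ p.2 (EuclideanSpace.single i 1)) :=
      contDiff_const.add (contDiff_fst.smul h2)
    exact ((hg.comp h1).clm_apply h3).clm_apply h3

end

/-! ### Consequences of the degree bounds -/

theorem IsProfile.derivWithin_nonneg {F : ℝ → ℝ} (hF : IsProfile F) {t : ℝ} (ht : 0 ≤ t) :
    0 ≤ derivWithin F (Ici 0) t := by
  obtain ⟨Φ, hΦ, hΦF⟩ := hF.exists_contDiff_extension
  have h1 : ∀ s ∈ Ioi (0 : ℝ), 0 ≤ deriv Φ s := fun s hs ↦ by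
    rw [(hΦF s (le_of_lt hs)).2]; exact (hF.deriv_pos s hs).le
  have h2 : closure (Ioi (0 : ℝ)) ⊆ {s | 0 ≤ deriv Φ s} :=
    closure_minimal h1 (isClosed_le continuous_const (hΦ.continuous_deriv le_rfl))
  rw [closure_Ioi] at h2
  rw [← (hΦF t ht).2]
  exact h2 ht

theorem IsProfile.pos {F : ℝ → ℝ} (hF : IsProfile F) {t : ℝ} (ht : 0 < t) : 0 < F t := by
  have hmono : StrictMonoOn F (Ici 0) := by
    refine strictMonoOn_of_deriv_pos (convex_Ici 0) hF.contDiffOn.continuousOn fun x hx ↦ ?_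
    rw [interior_Ici] at hx
    rw [← derivWithin_of_mem_nhds (Ici_mem_nhds hx)]
    exact hF.deriv_pos x hx
  simpa [hF.map_zero] using hmono (self_mem_Ici (a := (0 : ℝ))) (le_of_lt ht) ht

theorem IsProfile.mul_derivWithin_le {F : ℝ → ℝ} (hF : IsProfile F) (hd : upperDegree F ≤ 1)
    {t : ℝ} (ht : 0 ≤ t) : t * derivWithin F (Ici 0) t ≤ F t := by
  rcases ht.eq_or_lt with rfl | ht
  · simp [hF.map_zero]
  · have h1 := (le_iSup (fun t : Ioi (0 : ℝ) ↦
      ((t * derivWithin F (Ici 0) t / F t : ℝ) : EReal)) ⟨t, ht⟩).trans hd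
    have h2 : t * derivWithin F (Ici 0) t / F t ≤ 1 := by exact_mod_cast h1
    rwa [div_le_one (hF.pos ht)] at h2

theorem IsProfile.exists_mul_le_mul_derivWithin {F : ℝ → ℝ} (hF : IsProfile F)
    (hl : 0 < lowerDegree F) :
    ∃ l : ℝ, 0 < l ∧ ∀ t, 0 ≤ t → l * F t ≤ t * derivWithin F (Ici 0) t := by
  obtain ⟨l, hl0, hl1⟩ := EReal.lt_iff_exists_real_btwn.1 hl
  refine ⟨l, by exact_mod_cast hl0, fun t ht ↦ ?_⟩
  rcases ht.eq_or_lt with rfl | ht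
  · simp [hF.map_zero]
  · have h1 := hl1.le.trans (iInf_le (fun t : Ioi (0 : ℝ) ↦
      ((t * derivWithin F (Ici 0) t / F t : ℝ) : EReal)) ⟨t, ht⟩)
    have h2 : l ≤ t * derivWithin F (Ici 0) t / F t := by exact_mod_cast h1
    rwa [le_div_iff₀ (hF.pos ht)] at h2

/-! ### The weighted monotonicity inequality -/

section

variable {m n : ℕ} {N : Type*} [TopologicalSpace N]
  [ChartedSpace (EuclideanSpace ℝ (Fin n)) N] [IsManifold (𝓡 n) ∞ N]
  {h : ContMDiffRiemannianMetric (𝓡 n) ∞ (EuclideanSpace ℝ (Fin n))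
      (fun y : N ↦ TangentSpace (𝓡 n) y)}

/-- The stress-energy identity tested with the radial field `φ(|x|²) x`. The derivative `φ'` of `φ`
is only needed on `[0, ∞)`, the range of `|x|²`. -/
theorem IsFHarmonic.integral_radial_eq_zero {F : ℝ → ℝ} (hF : IsProfile F)
    {u : EuclideanSpace ℝ (Fin m) → N} (hu : ContMDiff (𝓡 m) (𝓡 n) 2 u)
    (hharm : IsFHarmonic F h u) {φ φ' : ℝ → ℝ}
    (hφ : ContDiff ℝ 2 fun x : EuclideanSpace ℝ (Fin m) ↦ φ (‖x‖ ^ 2))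
    (hφ' : ∀ s, 0 ≤ s → HasDerivAt φ (φ' s) s)
    (hc : HasCompactSupport fun x : EuclideanSpace ℝ (Fin m) ↦ φ (‖x‖ ^ 2)) :
    Integrable (fun x ↦ derivWithin F (Ici 0) (energyDensity h u x) *
        (2 * energyDensity h u x * φ (‖x‖ ^ 2) +
          2 * φ' (‖x‖ ^ 2) * pullbackMetric h u x x x) -
      F (energyDensity h u x) * (m * φ (‖x‖ ^ 2) + 2 * φ' (‖x‖ ^ 2) * ‖x‖ ^ 2)) ∧
    ∫ x, (derivWithin F (Ici 0) (energyDensity h u x) *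
        (2 * energyDensity h u x * φ (‖x‖ ^ 2) +
          2 * φ' (‖x‖ ^ 2) * pullbackMetric h u x x x) -
      F (energyDensity h u x) * (m * φ (‖x‖ ^ 2) + 2 * φ' (‖x‖ ^ 2) * ‖x‖ ^ 2)) = 0 := by
  set ξ : EuclideanSpace ℝ (Fin m) → EuclideanSpace ℝ (Fin m) := fun x ↦ φ (‖x‖ ^ 2) • x with hξ
  have hξ2 : ContDiff ℝ 2 ξ := hφ.smul contDiff_id
  have hξc : HasCompactSupport ξ := hc.smul_right
  have hder : ∀ x v, fderiv ℝ ξ x v =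
      φ (‖x‖ ^ 2) • v + (2 * φ' (‖x‖ ^ 2) * inner ℝ x v) • x := by
    intro x v
    have h1 : HasFDerivAt (fun x : EuclideanSpace ℝ (Fin m) ↦ φ (‖x‖ ^ 2))
        (φ' (‖x‖ ^ 2) • (2 • innerSL ℝ x)) x :=
      (hφ' _ (sq_nonneg _)).comp_hasFDerivAt x (hasStrictFDerivAt_norm_sq x).hasFDerivAt
    have h2 := h1.smul (hasFDerivAt_id x)
    have h3 : fderiv ℝ ξ x = _ := h2.fderiv
    rw [h3]
    simp [mul_assoc, mul_left_comm]
  have hin : ∀ (x : EuclideanSpace ℝ (Fin m)) i,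
      inner ℝ x (EuclideanSpace.single i (1 : ℝ)) = x i := fun x i ↦ by
    rw [EuclideanSpace.inner_single_right]; simp
  have h1 : ∀ x, ∑ i, pullbackMetric h u x (fderiv ℝ ξ x (EuclideanSpace.single i 1))
      (EuclideanSpace.single i 1) = 2 * energyDensity h u x * φ (‖x‖ ^ 2) +
          2 * φ' (‖x‖ ^ 2) * pullbackMetric h u x x x := by
    intro x
    have h3 : pullbackMetric h u x x x =
        ∑ i, x i * pullbackMetric h u x x (EuclideanSpace.single i 1) := by
      conv_lhs => rw [← sum_coord_smul_single x]
      rw [sum_coord_smul_single x, ← congrArg (pullbackMetric h u x x) (sum_coord_smul_single x),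
        map_sum]
      simp
    rw [h3, energyDensity_eq, mul_div_cancel₀ _ two_ne_zero, Finset.sum_mul, Finset.mul_sum,
      ← Finset.sum_add_distrib]
    refine Finset.sum_congr rfl fun i _ ↦ ?_
    rw [hder, hin]
    simp only [map_add, map_smul, add_apply, smul_apply, smul_eq_mul]
    ring
  have h2 : ∀ x, ∑ i, (fderiv ℝ ξ x (EuclideanSpace.single i 1)) i =
      m * φ (‖x‖ ^ 2) + 2 * φ' (‖x‖ ^ 2) * ‖x‖ ^ 2 := by
    intro x
    rw [EuclideanSpace.real_norm_sq_eq, Finset.mul_sum]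
    have : (m : ℝ) * φ (∑ i, x i ^ 2) = ∑ i : Fin m, φ (∑ i, x i ^ 2) := by simp
    rw [this, ← Finset.sum_add_distrib]
    refine Finset.sum_congr rfl fun i _ ↦ ?_
    rw [hder, hin]
    simp [EuclideanSpace.real_norm_sq_eq]
    ring
  have hmain := hharm.integral_stressEnergy_eq_zero hF hu hξ2 hξc
  simp_rw [h1, h2] at hmain
  exact hmain

/-- `|du(a)|² ≤ |du|² |a|²`: the operator norm of `du` is at most its Hilbert-Schmidt norm. -/
theorem pullbackMetric_self_le (u : EuclideanSpace ℝ (Fin m) → N) (x a : EuclideanSpace ℝ (Fin m)) :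
    pullbackMetric h u x a a ≤ 2 * energyDensity h u x * ‖a‖ ^ 2 := by
  set g := pullbackMetric h u x with hg
  have hpos : ∀ v, 0 ≤ g v v := pullbackMetric_self_nonneg h u x
  have hsymm : ∀ v w, g v w = g w v := pullbackMetric_symm h u x
  set s : Fin m → ℝ := fun i ↦ √(g (EuclideanSpace.single i 1) (EuclideanSpace.single i 1)) with hs
  have hcs : ∀ v w, |g v w| ≤ √(g v v) * √(g w w) := by
    intro v w
    rw [← Real.sqrt_mul (hpos v)]
    refine Real.abs_le_sqrt ?_
    -- Cauchy-Schwarz for a semidefinite form: its values on the line `v + t w` are nonnegative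
    have hq : ∀ t : ℝ, 0 ≤ g w w * (t * t) + 2 * g v w * t + g v v := by
      intro t
      have := hpos (v + t • w)
      simp only [map_add, map_smul, add_apply, smul_apply, smul_eq_mul] at this
      rw [hsymm w v] at this
      linarith
    have := discrim_le_zero hq
    rw [discrim] at this
    nlinarith
  have h1 : g a a = ∑ i, ∑ j, a i * a j * g (EuclideanSpace.single i 1)
      (EuclideanSpace.single j 1) := by
    conv_lhs => rw [← sum_coord_smul_single a]
    simp only [map_sum, map_smul, sum_apply, smul_apply, smul_eq_mul]
    refine Finset.sum_congr rfl fun i _ ↦ ?_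
    rw [Finset.mul_sum]
    refine Finset.sum_congr rfl fun j _ ↦ ?_
    rw [hsymm]; ring
  have h2 : g a a ≤ (∑ i, |a i| * s i) ^ 2 := by
    rw [h1, sq, Finset.sum_mul_sum]
    refine Finset.sum_le_sum fun i _ ↦ Finset.sum_le_sum fun j _ ↦ ?_
    refine (le_abs_self _).trans ?_
    rw [abs_mul, abs_mul]
    calc |a i| * |a j| * |g _ _| ≤ |a i| * |a j| * (s i * s j) := by gcongr; exact hcs _ _
      _ = _ := by ring
  refine h2.trans ((Finset.sum_mul_sq_le_sq_mul_sq _ _ _).trans_eq ?_)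
  rw [EuclideanSpace.real_norm_sq_eq, energyDensity_eq, mul_div_cancel₀ _ two_ne_zero, mul_comm]
  simp only [hs, Real.sq_sqrt (hpos _), sq_abs]
  rfl

/-- A smooth cutoff equal to `1` on `(-∞, 1]` and to `0` on `[2, ∞)`. -/
theorem exists_smooth_cutoff : ∃ θ : ℝ → ℝ, ContDiff ℝ 2 θ ∧ (∀ s, 0 ≤ θ s) ∧ (∀ s, θ s ≤ 1) ∧
    (∀ s ≤ 1, θ s = 1) ∧ (∀ s, 2 ≤ s → θ s = 0) ∧
    (∀ s, deriv θ s ≠ 0 → 1 ≤ s ∧ s ≤ 2) ∧ ∃ C, 0 < C ∧ ∀ s, |deriv θ s| ≤ C := by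
  have hsm : ContDiff ℝ 2 fun s : ℝ ↦ Real.smoothTransition (2 - s) :=
    Real.smoothTransition.contDiff.comp (contDiff_const.sub contDiff_id)
  have hsupp : ∀ s, deriv (fun s : ℝ ↦ Real.smoothTransition (2 - s)) s ≠ 0 → 1 ≤ s ∧ s ≤ 2 := by
    intro s hs
    by_contra hcon
    rw [not_and_or, not_le, not_le] at hcon
    refine hs ?_
    rcases hcon with hcon | hcon
    · have : (fun s : ℝ ↦ Real.smoothTransition (2 - s)) =ᶠ[𝓝 s] fun _ ↦ 1 := by
        filter_upwards [Iio_mem_nhds hcon] with t ht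
        exact Real.smoothTransition.one_of_one_le (by linarith [mem_Iio.1 ht])
      rw [this.deriv_eq, deriv_const]
    · have : (fun s : ℝ ↦ Real.smoothTransition (2 - s)) =ᶠ[𝓝 s] fun _ ↦ 0 := by
        filter_upwards [Ioi_mem_nhds hcon] with t ht
        exact Real.smoothTransition.zero_of_nonpos (by linarith [mem_Ioi.1 ht])
      rw [this.deriv_eq, deriv_const]
  obtain ⟨C, hC⟩ := (isCompact_Icc (a := (1 : ℝ)) (b := 2)).exists_bound_of_continuousOn
    (hsm.continuous_deriv (by simp)).continuousOn
  refine ⟨_, hsm, fun s ↦ Real.smoothTransition.nonneg _,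
    fun s ↦ Real.smoothTransition.le_one _,
    fun s hs ↦ Real.smoothTransition.one_of_one_le (by linarith),
    fun s hs ↦ Real.smoothTransition.zero_of_nonpos (by linarith), hsupp, max C 1, by simp,
    fun s ↦ ?_⟩
  by_cases hs : deriv (fun s : ℝ ↦ Real.smoothTransition (2 - s)) s = 0
  · rw [hs]; simp
  · exact (hC s (hsupp s hs)).trans (le_max_left _ _)

theorem isCompact_annulus (m : ℕ) (a b : ℝ) :
    IsCompact {x : EuclideanSpace ℝ (Fin m) | a ≤ ‖x‖ ^ 2 ∧ ‖x‖ ^ 2 ≤ b} := by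
  refine Metric.isCompact_of_isClosed_isBounded ?_ ?_
  · have hc : Continuous fun x : EuclideanSpace ℝ (Fin m) ↦ ‖x‖ ^ 2 := by fun_prop
    exact (isClosed_le continuous_const hc).inter (isClosed_le hc continuous_const)
  · refine Metric.isBounded_closedBall (x := 0) (r := √b) |>.subset fun x hx ↦ ?_
    rw [mem_closedBall_zero_iff]
    exact Real.le_sqrt_of_sq_le hx.2

theorem continuous_profile_energyDensity {F : ℝ → ℝ} (hF : IsProfile F)
    {u : EuclideanSpace ℝ (Fin m) → N} (hu : ContMDiff (𝓡 m) (𝓡 n) 2 u) :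
    Continuous (fun x ↦ F (energyDensity h u x)) ∧
      Continuous (fun x ↦ derivWithin F (Ici 0) (energyDensity h u x)) := by
  have he : ContDiff ℝ 1 (energyDensity h u) := by
    rw [← contDiffOn_univ]; exact contDiffOn_energyDensity isOpen_univ hu.contMDiffOn
  obtain ⟨Φ, hΦ, hΦF⟩ := hF.exists_contDiff_extension
  have h1 : (fun x ↦ F (energyDensity h u x)) = fun x ↦ Φ (energyDensity h u x) :=
    funext fun x ↦ (hΦF _ (energyDensity_nonneg h u x)).1.symm
  have h2 : (fun x ↦ derivWithin F (Ici 0) (energyDensity h u x)) =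
      fun x ↦ deriv Φ (energyDensity h u x) :=
    funext fun x ↦ (hΦF _ (energyDensity_nonneg h u x)).2.symm
  rw [h1, h2]
  exact ⟨hΦ.continuous.comp he.continuous, (hΦ.continuous_deriv le_rfl).comp he.continuous⟩

/-- A substitute for the monotonicity formula: a fixed weighted `F`-energy of the ball of radius
`R` is at most a constant times `R^(2 - m)` times the `F`-energy of the annulus
`R² ≤ |x|² ≤ 2 R²`. -/
theorem IsFHarmonic.exists_weighted_integral_le (hm : 2 < m) {F : ℝ → ℝ} (hF : IsProfile F)
    (hd : upperDegree F ≤ 1)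
    {u : EuclideanSpace ℝ (Fin m) → N} (hu : ContMDiff (𝓡 m) (𝓡 n) 2 u)
    (hharm : IsFHarmonic F h u) :
    ∃ C : ℝ, 0 < C ∧ ∀ R : ℝ, 0 < R →
      ∫ x in Metric.closedBall (0 : EuclideanSpace ℝ (Fin m)) R,
        (1 + ‖x‖ ^ 2) ^ (-(((m : ℝ) - 2) / 2)) / (1 + ‖x‖ ^ 2) * F (energyDensity h u x) ≤
      C * (R ^ 2) ^ (-(((m : ℝ) - 2) / 2)) *
        ∫ x in {x : EuclideanSpace ℝ (Fin m) | R ^ 2 ≤ ‖x‖ ^ 2 ∧ ‖x‖ ^ 2 ≤ 2 * R ^ 2},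
          F (energyDensity h u x) := by
  obtain ⟨θ, hθ, hθ0, -, hθ1, hθ2, hθs, C, hC0, hC⟩ := exists_smooth_cutoff
  obtain ⟨hFc, hfc⟩ := continuous_profile_energyDensity (h := h) hF hu
  set q : ℝ := ((m : ℝ) - 2) / 2 with hq
  have hm' : (3 : ℝ) ≤ m := by exact_mod_cast hm
  have hq0 : 0 < q := by rw [hq]; linarith
  refine ⟨4 * C, by positivity, fun R hR ↦ ?_⟩
  have hR2 : 0 < R ^ 2 := by positivity
  -- with this weight `-2 s ρ' s = (m - 2) ρ s * s / (1 + s)`, just short of `(m - 2) ρ s`: testing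
  -- with the pure power `s ^ (-q)` would give equality and lose the left-hand side
  set ρ : ℝ → ℝ := fun s ↦ (1 + s) ^ (-q) with hρ
  have hρ0 : ∀ s, 0 ≤ s → 0 < ρ s := fun s hs ↦ Real.rpow_pos_of_pos (by linarith) _
  have hρ' : ∀ s, 0 ≤ s → HasDerivAt ρ (-q * (ρ s / (1 + s))) s := by
    intro s hs
    have h1 : HasDerivAt (fun s : ℝ ↦ 1 + s) 1 s := (hasDerivAt_id s).const_add 1
    refine (h1.rpow_const (p := -q) (Or.inl (by linarith))).congr_deriv ?_
    rw [Real.rpow_sub_one (by linarith)]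
    ring
  set θR : ℝ → ℝ := fun s ↦ θ (s / R ^ 2) with hθR
  set θR' : ℝ → ℝ := fun s ↦ deriv θ (s / R ^ 2) / R ^ 2 with hθR'
  have hθRd : ∀ s, HasDerivAt θR (θR' s) s := by
    intro s
    have h1 : HasDerivAt (fun s : ℝ ↦ s / R ^ 2) (1 / R ^ 2) s := (hasDerivAt_id s).div_const _
    have h2 := ((hθ.differentiable (by simp)) (s / R ^ 2)).hasDerivAt
    exact (h2.comp s h1).congr_deriv (by rw [hθR']; ring)
  set A : Set (EuclideanSpace ℝ (Fin m)) := {x | R ^ 2 ≤ ‖x‖ ^ 2 ∧ ‖x‖ ^ 2 ≤ 2 * R ^ 2} with hA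
  have hAc : IsCompact A := isCompact_annulus m _ _
  have hnsq : ContDiff ℝ 2 fun x : EuclideanSpace ℝ (Fin m) ↦ ‖x‖ ^ 2 := contDiff_norm_sq ℝ
  have hθRx : ContDiff ℝ 2 fun x : EuclideanSpace ℝ (Fin m) ↦ θR (‖x‖ ^ 2) :=
    hθ.comp (hnsq.div_const _)
  have hρx : ContDiff ℝ 2 fun x : EuclideanSpace ℝ (Fin m) ↦ ρ (‖x‖ ^ 2) :=
    (contDiff_const.add hnsq).rpow_const_of_ne fun x ↦ by positivity
  have hθc : HasCompactSupport fun x : EuclideanSpace ℝ (Fin m) ↦ θR (‖x‖ ^ 2) := by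
    refine HasCompactSupport.intro (isCompact_annulus m 0 (2 * R ^ 2)) fun x hx ↦ ?_
    have hx' : 2 * R ^ 2 < ‖x‖ ^ 2 := by
      by_contra hcon
      exact hx ⟨sq_nonneg _, not_lt.1 hcon⟩
    exact hθ2 _ (by rw [le_div_iff₀ hR2]; exact hx'.le)
  have hθR0 : ∀ s, 0 ≤ θR s := fun s ↦ hθ0 _
  have hid := hharm.integral_radial_eq_zero hF hu (φ := fun s ↦ θR s * ρ s)
    (φ' := fun s ↦ θR' s * ρ s + θR s * (-q * (ρ s / (1 + s)))) (hθRx.mul hρx)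
    (fun s hs ↦ (hθRd s).mul (hρ' s hs)) hθc.mul_right
  have hFe0 : ∀ x, 0 ≤ F (energyDensity h u x) := fun x ↦ hF.nonneg _ (energyDensity_nonneg h u x)
  have hθ'c : Continuous fun x : EuclideanSpace ℝ (Fin m) ↦ θR' (‖x‖ ^ 2) := by
    have := hθ.continuous_deriv (by simp)
    exact (this.comp (by fun_prop)).div_const _
  have hρc := hρx.continuous
  have hθRc := hθRx.continuous
  have hdec : ∀ x : EuclideanSpace ℝ (Fin m), θR' (‖x‖ ^ 2) ≠ 0 → x ∈ A := by
    intro x hx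
    have h1 : deriv θ (‖x‖ ^ 2 / R ^ 2) ≠ 0 := fun h0 ↦ hx (by simp [hθR', h0])
    have h2 := hθs _ h1
    rw [le_div_iff₀ hR2, div_le_iff₀ hR2, one_mul] at h2
    exact h2
  have hθ'cs : HasCompactSupport fun x : EuclideanSpace ℝ (Fin m) ↦ θR' (‖x‖ ^ 2) :=
    HasCompactSupport.intro hAc fun x hx ↦ by
      by_contra hne
      exact hx (hdec x hne)
  have hpos1 : ∀ x : EuclideanSpace ℝ (Fin m), (0 : ℝ) < 1 + ‖x‖ ^ 2 := fun x ↦ by positivity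
  have hwc : Continuous fun x : EuclideanSpace ℝ (Fin m) ↦ ρ (‖x‖ ^ 2) / (1 + ‖x‖ ^ 2) :=
    hρc.div (by fun_prop) fun x ↦ (hpos1 x).ne'
  set L : EuclideanSpace ℝ (Fin m) → ℝ := fun x ↦
    θR (‖x‖ ^ 2) * (ρ (‖x‖ ^ 2) / (1 + ‖x‖ ^ 2) * F (energyDensity h u x)) with hL
  set B : EuclideanSpace ℝ (Fin m) → ℝ := fun x ↦
    |θR' (‖x‖ ^ 2)| * (2 * ρ (‖x‖ ^ 2) * ‖x‖ ^ 2 * F (energyDensity h u x)) with hB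
  have hLi : Integrable L :=
    Continuous.integrable_of_hasCompactSupport (hθRc.mul (hwc.mul hFc)) hθc.mul_right
  have hBi : Integrable B := by
    refine Continuous.integrable_of_hasCompactSupport (hθ'c.abs.mul
      (((continuous_const.mul hρc).mul (by fun_prop)).mul hFc)) ?_
    exact (hθ'cs.comp_left (g := fun t : ℝ ↦ |t|) abs_zero).mul_right
  have hpt : ∀ x, derivWithin F (Ici 0) (energyDensity h u x) *
        (2 * energyDensity h u x * (θR (‖x‖ ^ 2) * ρ (‖x‖ ^ 2)) +
          2 * (θR' (‖x‖ ^ 2) * ρ (‖x‖ ^ 2) +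
            θR (‖x‖ ^ 2) * (-q * (ρ (‖x‖ ^ 2) / (1 + ‖x‖ ^ 2)))) * pullbackMetric h u x x x) -
      F (energyDensity h u x) * (m * (θR (‖x‖ ^ 2) * ρ (‖x‖ ^ 2)) +
        2 * (θR' (‖x‖ ^ 2) * ρ (‖x‖ ^ 2) +
            θR (‖x‖ ^ 2) * (-q * (ρ (‖x‖ ^ 2) / (1 + ‖x‖ ^ 2)))) * ‖x‖ ^ 2) ≤ B x - L x := by
    intro x
    have he0 := energyDensity_nonneg h u x
    have hf0 := hF.derivWithin_nonneg he0
    have hfF := hF.mul_derivWithin_le hd he0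
    have hg0 := pullbackMetric_self_nonneg h u x x
    have hgs := pullbackMetric_self_le (h := h) u x x
    have hs0 : 0 ≤ ‖x‖ ^ 2 := sq_nonneg _
    have hρp := hρ0 _ hs0
    have hθp := hθR0 (‖x‖ ^ 2)
    have hFp := hFe0 x
    simp only [hL, hB]
    have hmq : (m : ℝ) = 2 * q + 2 := by rw [hq]; ring
    rw [hmq]
    generalize energyDensity h u x = e at *
    generalize pullbackMetric h u x x x = g at *
    generalize derivWithin F (Ici 0) e = f at *
    generalize F e = Fe at *
    generalize ‖x‖ ^ 2 = s at *
    generalize θR' s = c at *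
    generalize θR s = w at *
    have hk : 0 < ρ s / (1 + s) := by positivity
    have hρk : ρ s = (ρ s / (1 + s)) * (1 + s) := by field_simp
    have hfg0 : 0 ≤ f * g := mul_nonneg hf0 hg0
    have hfg : f * g ≤ 2 * (s * Fe) := by
      calc f * g ≤ f * (2 * e * s) := by gcongr
        _ = 2 * (s * (e * f)) := by ring
        _ ≤ 2 * (s * Fe) := by gcongr
    -- `f * g` lies in `[0, 2 * s * Fe]`, so `|f * g - s * Fe| ≤ s * Fe`: the cutoff term is
    -- bounded whatever the sign of its derivative
    have habs : c * (f * g - s * Fe) ≤ |c| * (s * Fe) := by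
      calc c * (f * g - s * Fe) ≤ |c * (f * g - s * Fe)| := le_abs_self _
        _ = |c| * |f * g - s * Fe| := abs_mul _ _
        _ ≤ |c| * (s * Fe) := by
          gcongr
          rw [abs_le]; constructor <;> linarith
    have t1 : 2 * ρ s * (c * (f * g - s * Fe)) ≤ 2 * ρ s * (|c| * (s * Fe)) := by gcongr
    have t2 : 2 * (w * ρ s) * (e * f) ≤ 2 * (w * ρ s) * Fe := by gcongr
    have t3 : 0 ≤ 2 * q * w * (ρ s / (1 + s)) * (f * g) := by positivity
    have t4 : w * (ρ s / (1 + s)) * Fe ≤ 2 * q * (w * (ρ s / (1 + s)) * Fe) :=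
      le_mul_of_one_le_left (by positivity) (by rw [hq]; linarith)
    have t5 : 2 * q * w * (ρ s) * Fe = 2 * q * w * (ρ s / (1 + s)) * (1 + s) * Fe := by
      field_simp
    generalize ρ s / (1 + s) = k at *
    nlinarith
  have hineq : ∫ x, L x ≤ ∫ x, B x := by
    have h1 : (0 : ℝ) ≤ ∫ x, (B x - L x) := by
      rw [← hid.2]
      exact integral_mono hid.1 (hBi.sub hLi) hpt
    rw [integral_sub hBi hLi] at h1
    linarith
  have hL0 : ∀ x, 0 ≤ L x := fun x ↦
    mul_nonneg (hθR0 _) (mul_nonneg (div_pos (hρ0 _ (sq_nonneg _)) (hpos1 x)).le (hFe0 x))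
  calc ∫ x in Metric.closedBall (0 : EuclideanSpace ℝ (Fin m)) R,
        ρ (‖x‖ ^ 2) / (1 + ‖x‖ ^ 2) * F (energyDensity h u x)
      = ∫ x in Metric.closedBall (0 : EuclideanSpace ℝ (Fin m)) R, L x := by
        refine setIntegral_congr_fun Metric.isClosed_closedBall.measurableSet fun x hx ↦ ?_
        have h1 : θR (‖x‖ ^ 2) = 1 := by
          refine hθ1 _ ((div_le_one hR2).2 ?_)
          have := mem_closedBall_zero_iff.1 hx
          gcongr
        simp [hL, h1]
    _ ≤ ∫ x, L x := setIntegral_le_integral hLi (.of_forall hL0)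
    _ ≤ ∫ x, B x := hineq
    _ = ∫ x in A, B x := by
        refine (setIntegral_eq_integral_of_forall_compl_eq_zero fun x hx ↦ ?_).symm
        have : θR' (‖x‖ ^ 2) = 0 := by
          by_contra hne
          exact hx (hdec x hne)
        simp [hB, this]
    _ ≤ ∫ x in A, 4 * C * (R ^ 2) ^ (-q) * F (energyDensity h u x) := by
        refine setIntegral_mono_on hBi.integrableOn
          ((continuous_const.mul hFc).continuousOn.integrableOn_compact hAc)
          hAc.measurableSet fun x hx ↦ ?_
        have h1 : |θR' (‖x‖ ^ 2)| ≤ C / R ^ 2 := by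
          simp only [hθR', abs_div, abs_of_pos hR2]
          gcongr
          exact hC _
        have h2 : ρ (‖x‖ ^ 2) ≤ (R ^ 2) ^ (-q) :=
          Real.rpow_le_rpow_of_nonpos hR2 (by linarith [hx.1]) (by linarith)
        have h3 : 0 < (R ^ 2) ^ (-q) := Real.rpow_pos_of_pos hR2 _
        have h4 := hFe0 x
        calc B x ≤ (C / R ^ 2) * (2 * (R ^ 2) ^ (-q) * (2 * R ^ 2) * F (energyDensity h u x)) := by
              simp only [hB]
              gcongr
              exact hx.2
          _ = 4 * C * (R ^ 2) ^ (-q) * F (energyDensity h u x) := by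
              field_simp
              ring
    _ = _ := by rw [integral_const_mul]

end

/-! ### The metric in coordinates near a point -/

theorem exists_pos_mul_norm_sq_le {E : Type*} [NormedAddCommGroup E] [NormedSpace ℝ E]
    [FiniteDimensional ℝ E] (B : E →L[ℝ] E →L[ℝ] ℝ) (hB : ∀ a, a ≠ 0 → 0 < B a a) :
    ∃ c, 0 < c ∧ ∀ a, c * ‖a‖ ^ 2 ≤ B a a := by
  have hcont : Continuous fun a ↦ B a a := by fun_prop
  rcases (Metric.sphere (0 : E) 1).eq_empty_or_nonempty with hS | hS
  · refine ⟨1, one_pos, fun a ↦ ?_⟩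
    rcases eq_or_ne a 0 with rfl | ha
    · simp
    · have : ‖a‖⁻¹ • a ∈ Metric.sphere (0 : E) 1 := by
        simp [norm_smul, norm_ne_zero_iff.2 ha]
      simp [hS] at this
  · obtain ⟨b, hb, hmin⟩ := (isCompact_sphere (0 : E) 1).exists_isMinOn hS hcont.continuousOn
    have hb1 : ‖b‖ = 1 := by simpa using hb
    refine ⟨B b b, hB b fun h0 ↦ by simp [h0] at hb1, fun a ↦ ?_⟩
    rcases eq_or_ne a 0 with rfl | ha
    · simp
    · have hn : ‖a‖ ≠ 0 := norm_ne_zero_iff.2 ha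
      have hmem : ‖a‖⁻¹ • a ∈ Metric.sphere (0 : E) 1 := by simp [norm_smul, hn]
      have h1 : B b b ≤ B (‖a‖⁻¹ • a) (‖a‖⁻¹ • a) := hmin hmem
      simp only [map_smul, smul_apply, smul_eq_mul] at h1
      calc B b b * ‖a‖ ^ 2 ≤ ‖a‖⁻¹ * (‖a‖⁻¹ * B a a) * ‖a‖ ^ 2 := by gcongr
        _ = B a a := by field_simp

set_option maxSynthPendingDepth 3 in
/-- Near a point, the radial derivative of a `C¹` field of inner products is dominated by the
field. -/
theorem exists_radius_abs_fderiv_le {E : Type*} [NormedAddCommGroup E] [NormedSpace ℝ E]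
    [FiniteDimensional ℝ E] {H : E → E →L[ℝ] E →L[ℝ] ℝ} {T : Set E} (hT : IsOpen T)
    (hH : ContDiffOn ℝ 1 H T) {c : E} (hc : c ∈ T) (hpos : ∀ a, a ≠ 0 → 0 < H c a a) :
    ∃ ρ C : ℝ, 0 < ρ ∧ 0 < C ∧ Metric.ball c (2 * ρ) ⊆ T ∧ ∀ y ∈ Metric.ball c ρ, ∀ a,
      |fderiv ℝ H y (y - c) a a| ≤ H y a a ∧ H y a a ≤ C * ‖a‖ ^ 2 := by
  obtain ⟨c₀, hc₀, hlow⟩ := exists_pos_mul_norm_sq_le (H c) hpos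
  have hHc : ContinuousAt H c := hH.continuousOn.continuousAt (hT.mem_nhds hc)
  have hdc : ContinuousAt (fderiv ℝ H) c :=
    (hH.continuousOn_fderiv_of_isOpen hT le_rfl).continuousAt (hT.mem_nhds hc)
  set M := ‖fderiv ℝ H c‖ + 1 with hM
  have hM0 : 0 < M := by positivity
  have e1 : ∀ᶠ y in 𝓝 c, ‖H y - H c‖ < c₀ / 2 := by
    have := Metric.continuousAt_iff'.1 hHc (c₀ / 2) (by positivity)
    simpa only [dist_eq_norm] using this
  have e2 : ∀ᶠ y in 𝓝 c, ‖fderiv ℝ H y‖ < M :=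
    hdc.norm.eventually_lt continuousAt_const (by rw [hM]; linarith)
  have e3 : ∀ᶠ y in 𝓝 c, y ∈ T := hT.mem_nhds hc
  obtain ⟨r, hr, hball⟩ := Metric.eventually_nhds_iff_ball.1 (e1.and (e2.and e3))
  refine ⟨min (r / 2) (c₀ / (2 * M)), ‖H c‖ + c₀ / 2, by positivity, by positivity, ?_, ?_⟩
  · refine fun y hy ↦ (hball y (Metric.ball_subset_ball ?_ hy)).2.2
    linarith [min_le_left (r / 2) (c₀ / (2 * M))]
  · intro y hy a
    have hyr : y ∈ Metric.ball c r := Metric.ball_subset_ball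
      ((min_le_left _ _).trans (by linarith)) hy
    obtain ⟨h1, h2, -⟩ := hball y hyr
    have h3 : ‖y - c‖ ≤ c₀ / (2 * M) := by
      rw [← dist_eq_norm]
      exact (Metric.mem_ball.1 hy).le.trans (min_le_right _ _)
    have h4 : |(H y - H c) a a| ≤ c₀ / 2 * ‖a‖ ^ 2 := by
      calc |(H y - H c) a a| ≤ ‖H y - H c‖ * ‖a‖ * ‖a‖ := (H y - H c).le_opNorm₂ a a
        _ ≤ c₀ / 2 * ‖a‖ * ‖a‖ := by gcongr
        _ = _ := by ring
    have h5 : |H c a a| ≤ ‖H c‖ * ‖a‖ ^ 2 := by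
      calc |H c a a| ≤ ‖H c‖ * ‖a‖ * ‖a‖ := (H c).le_opNorm₂ a a
        _ = _ := by ring
    have h6 : |fderiv ℝ H y (y - c) a a| ≤ c₀ / 2 * ‖a‖ ^ 2 := by
      calc |fderiv ℝ H y (y - c) a a| ≤ ‖fderiv ℝ H y (y - c)‖ * ‖a‖ * ‖a‖ :=
            (fderiv ℝ H y (y - c)).le_opNorm₂ a a
        _ ≤ (M * (c₀ / (2 * M))) * ‖a‖ * ‖a‖ := by
            gcongr
            exact ((fderiv ℝ H y).le_opNorm _).trans (by gcongr)
        _ = _ := by field_simp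
    have h7 := hlow a
    rw [sub_apply, sub_apply] at h4
    rw [abs_le] at h4 h5
    refine ⟨h6.trans ?_, ?_⟩ <;> linarith [h4.1, h4.2, h5.2]

/-! ### The Caccioppoli inequality -/

section

variable {m n : ℕ} {N : Type*} [TopologicalSpace N]
  [ChartedSpace (EuclideanSpace ℝ (Fin n)) N] [IsManifold (𝓡 n) ∞ N]
  {h : ContMDiffRiemannianMetric (𝓡 n) ∞ (EuclideanSpace ℝ (Fin n))
      (fun y : N ↦ TangentSpace (𝓡 n) y)}

theorem pullbackMetric_extChartAt_symm_pos (p₀ : N) {a : EuclideanSpace ℝ (Fin n)} (ha : a ≠ 0) :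
    0 < pullbackMetric h (extChartAt (𝓡 n) p₀).symm (extChartAt (𝓡 n) p₀ p₀) a a := by
  rw [pullbackMetric_apply]
  refine h.pos _ _ fun h0 ↦ ha ?_
  have h1 := isInvertible_mfderivWithin_extChartAt_symm (I := 𝓡 n) (mem_extChartAt_target p₀)
  rw [modelWithCornersSelf_coe, range_id, mfderivWithin_univ] at h1
  exact h1.injective (h0.trans (map_zero _).symm)

set_option maxSynthPendingDepth 3 in
/-- A Caccioppoli inequality, obtained from the first variation along `(1 + t ζ²) v`, where `v`
denotes `u` in coordinates centred at `p₀`: if `u` stays in a small coordinate ball on `O ⊇ supp ζ`,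
the energy weighted by `ζ²` is bounded by the metric square of `v` weighted by `|∇ζ|²`. -/
theorem IsFHarmonic.setIntegral_cutoff_le {F : ℝ → ℝ} (hF : IsProfile F)
    {u : EuclideanSpace ℝ (Fin m) → N} (hu : ContMDiff (𝓡 m) (𝓡 n) 2 u)
    (hharm : IsFHarmonic F h u) {p₀ : N} {ρ : ℝ}
    (hρT : Metric.ball (extChartAt (𝓡 n) p₀ p₀) (2 * ρ) ⊆ (extChartAt (𝓡 n) p₀).target)
    (hρ : ∀ y ∈ Metric.ball (extChartAt (𝓡 n) p₀ p₀) ρ, ∀ a,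
      |fderiv ℝ (pullbackMetric h (extChartAt (𝓡 n) p₀).symm) y
        (y - extChartAt (𝓡 n) p₀ p₀) a a| ≤ pullbackMetric h (extChartAt (𝓡 n) p₀).symm y a a)
    {O : Set (EuclideanSpace ℝ (Fin m))} (hO : IsOpen O)
    (hsource : ∀ x ∈ O, u x ∈ (extChartAt (𝓡 n) p₀).source)
    (hball : ∀ x ∈ O, extChartAt (𝓡 n) p₀ (u x) ∈ Metric.ball (extChartAt (𝓡 n) p₀ p₀) ρ)
    {ζ : EuclideanSpace ℝ (Fin m) → ℝ} (hζ : ContDiff ℝ 2 ζ) (hζ0 : ∀ x, 0 ≤ ζ x)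
    (hζ1 : ∀ x, ζ x ≤ 1) (hc : HasCompactSupport ζ) (hζO : tsupport ζ ⊆ O) :
    ∫ x in tsupport ζ, derivWithin F (Ici 0) (energyDensity h u x) *
        (ζ x ^ 2 * energyDensity h u x) ≤
      8 * ∫ x in tsupport ζ, derivWithin F (Ici 0) (energyDensity h u x) *
        ((∑ i, fderiv ℝ ζ x (EuclideanSpace.single i 1) ^ 2) *
          pullbackMetric h (extChartAt (𝓡 n) p₀).symm (extChartAt (𝓡 n) p₀ (u x))
            (extChartAt (𝓡 n) p₀ (u x) - extChartAt (𝓡 n) p₀ p₀)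
            (extChartAt (𝓡 n) p₀ (u x) - extChartAt (𝓡 n) p₀ p₀)) := by
  classical
  obtain ⟨-, hfc⟩ := continuous_profile_energyDensity (h := h) hF hu
  have he : ContDiffOn ℝ 1 (energyDensity h u) univ :=
    contDiffOn_energyDensity isOpen_univ hu.contMDiffOn
  rw [contDiffOn_univ] at he
  set χ := extChartAt (𝓡 n) p₀ with hχ
  set c := χ p₀ with hcdef
  set ψ : EuclideanSpace ℝ (Fin n) → N := ⇑(extChartAt (𝓡 n) p₀).symm with hψ
  set H := pullbackMetric h ψ with hH
  have hT : IsOpen χ.target := isOpen_extChartAt_target p₀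
  have hψs : ContMDiffOn (𝓡 n) (𝓡 n) 2 ψ χ.target :=
    (contMDiffOn_extChartAt_symm (n := ∞) p₀).of_le
      ENat.LEInfty.out
  have hHs : ContDiffOn ℝ 1 H χ.target := contDiffOn_pullbackMetric h hT hψs
  set v : EuclideanSpace ℝ (Fin m) → EuclideanSpace ℝ (Fin n) := fun x ↦ χ (u x) - c with hv
  have hvs : ContDiffOn ℝ 2 v O := by
    have h1 : ContMDiffOn (𝓡 n) (𝓡 n) 2 χ (chartAt (EuclideanSpace ℝ (Fin n)) p₀).source :=
      (contMDiffOn_extChartAt (n := ∞)).of_le ENat.LEInfty.out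
    have h2 : ContMDiffOn (𝓡 m) (𝓡 n) 2 (fun x ↦ χ (u x)) O :=
      h1.comp hu.contMDiffOn fun x hx ↦ by
        have := hsource x hx
        rwa [extChartAt_source] at this
    exact (contMDiffOn_iff_contDiffOn.1 h2).sub contDiffOn_const
  have hvn : ∀ x ∈ O, ‖v x‖ < ρ := fun x hx ↦ by
    have := hball x hx
    rwa [Metric.mem_ball, dist_eq_norm] at this
  set η : EuclideanSpace ℝ (Fin m) → ℝ := fun x ↦ ζ x ^ 2 with hη
  have hη2 : ContDiff ℝ 2 η := hζ.pow 2
  set w : ℝ → EuclideanSpace ℝ (Fin m) → EuclideanSpace ℝ (Fin n) := fun t x ↦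
    c + (1 + t * η x) • v x with hw
  -- the factor `1 + t η` is at most `2`, hence the ball of radius `2 * ρ` in `hρT`
  have hwT : ∀ t ∈ Ioo (-1 : ℝ) 1, ∀ x ∈ O, w t x ∈ χ.target := by
    intro t ht x hx
    refine hρT ?_
    rw [Metric.mem_ball, dist_eq_norm]
    have h1 : |1 + t * η x| ≤ 2 := by
      have h3 : 0 ≤ η x := sq_nonneg _
      have h4 : η x ≤ 1 := pow_le_one₀ (hζ0 x) (hζ1 x)
      rw [abs_le]
      constructor <;> nlinarith [ht.1, ht.2]
    calc ‖w t x - c‖ = |1 + t * η x| * ‖v x‖ := by simp [hw, norm_smul]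
      _ ≤ 2 * ‖v x‖ := by gcongr
      _ < 2 * ρ := by linarith [hvn x hx]
  have hw0 : ∀ x, w 0 x = χ (u x) := fun x ↦ by simp [hw, hv]
  have hwη : ∀ t x, ζ x = 0 → w t x = χ (u x) := fun t x hx ↦ by simp [hw, hv, hη, hx]
  set U : ℝ → EuclideanSpace ℝ (Fin m) → N := fun t x ↦ if x ∈ O then ψ (w t x) else u x with hUdef
  have hUO : ∀ t, ∀ x ∈ O, U t x = ψ (w t x) := fun t x hx ↦ by simp [hUdef, hx]
  have hUK : ∀ t, ∀ x ∉ tsupport ζ, U t x = u x := by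
    intro t x hx
    by_cases hxO : x ∈ O
    · rw [hUO t x hxO, hwη t x (image_eq_zero_of_notMem_tsupport hx)]
      exact χ.left_inv (hsource x hxO)
    · simp [hUdef, hxO]
  have hws : ContDiffOn ℝ 2 (fun p : ℝ × EuclideanSpace ℝ (Fin m) ↦ w p.1 p.2)
      (Ioo (-1) 1 ×ˢ O) := by
    have h1 : ContDiffOn ℝ 2 (fun p : ℝ × EuclideanSpace ℝ (Fin m) ↦ v p.2) (Ioo (-1) 1 ×ˢ O) :=
      hvs.comp contDiffOn_snd fun p hp ↦ hp.2
    have h2 : ContDiff ℝ 2 (fun p : ℝ × EuclideanSpace ℝ (Fin m) ↦ 1 + p.1 * η p.2) := by fun_prop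
    exact contDiffOn_const.add (h2.contDiffOn.smul h1)
  have hU : IsVariation (n := n) u 1 (tsupport ζ) U := by
    refine ⟨one_pos, hc, ?_, fun x ↦ ?_, fun t _ x hx ↦ hUK t x hx⟩
    · rintro ⟨t, x⟩ ⟨ht, -⟩
      by_cases hxO : x ∈ O
      · have h1 : ContMDiffOn 𝓘(ℝ, ℝ × EuclideanSpace ℝ (Fin m)) (𝓡 n) 2
            (fun p : ℝ × EuclideanSpace ℝ (Fin m) ↦ ψ (w p.1 p.2)) (Ioo (-1) 1 ×ˢ O) :=
          hψs.comp (contMDiffOn_iff_contDiffOn.2 hws) fun p hp ↦ hwT p.1 hp.1 p.2 hp.2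
        have h2 := (h1.congr (f₁ := fun p : ℝ × EuclideanSpace ℝ (Fin m) ↦ U p.1 p.2)
          fun p hp ↦ hUO p.1 p.2 hp.2).contMDiffAt ((isOpen_Ioo.prod hO).mem_nhds ⟨ht, hxO⟩)
        exact h2.contMDiffWithinAt
      · have h1 : ContMDiff 𝓘(ℝ, ℝ × EuclideanSpace ℝ (Fin m)) (𝓡 n) 2
            (fun p : ℝ × EuclideanSpace ℝ (Fin m) ↦ u p.2) :=
          hu.comp (contMDiff_iff_contDiff.2 contDiff_snd)
        have h2 : (fun p : ℝ × EuclideanSpace ℝ (Fin m) ↦ U p.1 p.2) =ᶠ[𝓝 (t, x)]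
            fun p ↦ u p.2 := by
          have : (Prod.snd ⁻¹' (tsupport ζ)ᶜ : Set (ℝ × EuclideanSpace ℝ (Fin m))) ∈ 𝓝 (t, x) :=
            ((isClosed_tsupport ζ).isOpen_compl.preimage continuous_snd).mem_nhds
              fun hx ↦ hxO (hζO hx)
          filter_upwards [this] with p hp
          exact hUK p.1 p.2 hp
        exact (h1.contMDiffAt.congr_of_eventuallyEq h2).contMDiffWithinAt
    · by_cases hxO : x ∈ O
      · rw [hUO 0 x hxO, hw0]
        exact χ.left_inv (hsource x hxO)
      · simp [hUdef, hxO]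
  have hU0 : U 0 = u := funext hU.map_zero
  have hvd : ∀ x ∈ O, HasFDerivAt v (fderiv ℝ v x) x := fun x hx ↦
    ((hvs.differentiableOn two_ne_zero).differentiableAt (hO.mem_nhds hx)).hasFDerivAt
  have hηd : ∀ x, HasFDerivAt η (fderiv ℝ η x) x := fun x ↦
    (hη2.differentiable two_ne_zero x).hasFDerivAt
  set b : ℝ → EuclideanSpace ℝ (Fin m) → Fin m → EuclideanSpace ℝ (Fin n) := fun t x i ↦
    (1 + t * η x) • fderiv ℝ v x (EuclideanSpace.single i 1) +
      (t * fderiv ℝ η x (EuclideanSpace.single i 1)) • v x with hb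
  have hform : ∀ t ∈ Ioo (-1 : ℝ) 1, ∀ x ∈ O,
      energyDensity h (U t) x = (∑ i, H (w t x) (b t x i) (b t x i)) / 2 := by
    intro t ht x hx
    have h1 : U t =ᶠ[𝓝 x] fun x ↦ ψ (w t x) := by
      filter_upwards [hO.mem_nhds hx] with y hy
      exact hUO t y hy
    have h2 : HasFDerivAt (fun x ↦ 1 + t * η x) (t • fderiv ℝ η x) x :=
      ((hηd x).const_mul t).const_add 1
    have h3 := (h2.smul (hvd x hx)).const_add c
    have h4 : ∀ i, fderiv ℝ (w t) x (EuclideanSpace.single i 1) = b t x i := by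
      intro i
      have h5 : fderiv ℝ (w t) x = _ := h3.fderiv
      rw [h5]
      simp [hb]
    rw [energyDensity_eq, pullbackMetric_congr h h1]
    congr 1
    refine Finset.sum_congr rfl fun i _ ↦ ?_
    rw [pullbackMetric_comp h (f := ψ) (ψ := w t)
      ((hψs.contMDiffAt (hT.mem_nhds (hwT t ht x hx))).mdifferentiableAt two_ne_zero)
      h3.differentiableAt, h4]
  have h0mem : (0 : ℝ) ∈ Ioo (-1 : ℝ) 1 := by simp
  set D : EuclideanSpace ℝ (Fin m) → ℝ := fun x ↦
    ∑ i, (H (χ (u x)) (η x • fderiv ℝ v x (EuclideanSpace.single i 1) +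
        fderiv ℝ η x (EuclideanSpace.single i 1) • v x)
        (fderiv ℝ v x (EuclideanSpace.single i 1)) +
      fderiv ℝ H (χ (u x)) (η x • v x) (fderiv ℝ v x (EuclideanSpace.single i 1))
        (fderiv ℝ v x (EuclideanSpace.single i 1)) / 2) with hDdef
  have hD : ∀ x ∈ tsupport ζ, HasDerivAt (fun t ↦ energyDensity h (U t) x) (D x) 0 := by
    intro x hx
    have hxO := hζO hx
    have h1 : (fun t ↦ energyDensity h (U t) x) =ᶠ[𝓝 0]
        fun t ↦ (∑ i, H (w t x) (b t x i) (b t x i)) / 2 := by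
      filter_upwards [Ioo_mem_nhds (by norm_num : (-1 : ℝ) < 0) one_pos] with t ht
      exact hform t ht x hxO
    refine HasDerivAt.congr_of_eventuallyEq ?_ h1
    have hlin : ∀ s : ℝ, HasDerivAt (fun t : ℝ ↦ t * s) s 0 := fun s ↦ by
      simpa using (hasDerivAt_id (0 : ℝ)).mul_const s
    have h2 : HasDerivAt (fun t ↦ w t x) (η x • v x) 0 :=
      (((hlin (η x)).const_add 1).smul_const (v x)).const_add c
    have h3 : ∀ i, HasDerivAt (fun t ↦ b t x i)
        (η x • fderiv ℝ v x (EuclideanSpace.single i 1) +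
          fderiv ℝ η x (EuclideanSpace.single i 1) • v x) 0 := fun i ↦
      (((hlin (η x)).const_add 1).smul_const _).add ((hlin _).smul_const _)
    have h4 : DifferentiableAt ℝ H (χ (u x)) :=
      (hHs.differentiableOn one_ne_zero).differentiableAt
        (hT.mem_nhds (χ.map_source (hsource x hxO)))
    have h5 := hasDerivAt_half_sum_apply_apply (hw0 x) h4 (pullbackMetric_symm h ψ _) h2 h3
    have hb0 : ∀ i, b 0 x i = fderiv ℝ v x (EuclideanSpace.single i 1) := fun i ↦ by simp [hb]
    simpa only [hb0] using h5
  have hG : ContDiffOn ℝ 1 (fun p : ℝ × EuclideanSpace ℝ (Fin m) ↦ energyDensity h (U p.1) p.2)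
      (Ioo (-1) 1 ×ˢ O) := by
    refine ContDiffOn.congr (f := fun p : ℝ × EuclideanSpace ℝ (Fin m) ↦
      (∑ i, H (w p.1 p.2) (b p.1 p.2 i) (b p.1 p.2 i)) / 2) ?_ fun p hp ↦ hform p.1 hp.1 p.2 hp.2
    refine ContDiffOn.div_const (ContDiffOn.sum fun i _ ↦ ?_) 2
    have h1 : ContDiffOn ℝ 1 (fun p : ℝ × EuclideanSpace ℝ (Fin m) ↦ H (w p.1 p.2))
        (Ioo (-1) 1 ×ˢ O) :=
      hHs.comp (hws.of_le one_le_two) fun p hp ↦ hwT p.1 hp.1 p.2 hp.2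
    have h2 : ContDiffOn ℝ 1 (fun p : ℝ × EuclideanSpace ℝ (Fin m) ↦ v p.2) (Ioo (-1) 1 ×ˢ O) :=
      (hvs.of_le one_le_two).comp contDiffOn_snd fun p hp ↦ hp.2
    have h3 : ContDiffOn ℝ 1 (fun p : ℝ × EuclideanSpace ℝ (Fin m) ↦
        fderiv ℝ v p.2 (EuclideanSpace.single i 1)) (Ioo (-1) 1 ×ˢ O) :=
      ((hvs.fderiv_of_isOpen hO (by norm_num)).comp contDiffOn_snd fun p hp ↦ hp.2).clm_apply
        contDiffOn_const
    have h4 : ContDiff ℝ 1 (fun p : ℝ × EuclideanSpace ℝ (Fin m) ↦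
        p.1 * fderiv ℝ η p.2 (EuclideanSpace.single i 1)) :=
      contDiff_fst.mul (((hη2.fderiv_right (by norm_num)).comp contDiff_snd).clm_apply
        contDiff_const)
    have h5 : ContDiff ℝ 1 (fun p : ℝ × EuclideanSpace ℝ (Fin m) ↦ 1 + p.1 * η p.2) := by
      have := hη2.of_le one_le_two
      fun_prop
    have h6 : ContDiffOn ℝ 1 (fun p : ℝ × EuclideanSpace ℝ (Fin m) ↦ b p.1 p.2 i)
        (Ioo (-1) 1 ×ˢ O) := (h5.contDiffOn.smul h3).add (h4.contDiffOn.smul h2)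
    exact (h1.clm_apply h6).clm_apply h6
  obtain ⟨hDi, hvar⟩ := hharm.setIntegral_deriv_eq_zero hF hU hO hζO hG hD
  have hlow : ∀ x ∈ tsupport ζ, 1 / 2 * (η x * energyDensity h u x) -
      4 * ((∑ i, fderiv ℝ ζ x (EuclideanSpace.single i 1) ^ 2) * H (χ (u x)) (v x) (v x)) ≤
        D x := by
    intro x hx
    have hxO := hζO hx
    have h1 := hform 0 h0mem x hxO
    rw [hU0, hw0] at h1
    have hb0 : ∀ i, b 0 x i = fderiv ℝ v x (EuclideanSpace.single i 1) := fun i ↦ by simp [hb]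
    simp only [hb0] at h1
    rw [h1, hDdef, Finset.sum_mul, Finset.sum_div, Finset.mul_sum, Finset.mul_sum,
      Finset.mul_sum, ← Finset.sum_sub_distrib]
    refine Finset.sum_le_sum fun i _ ↦ ?_
    have hηi : fderiv ℝ η x (EuclideanSpace.single i 1) =
        2 * ζ x * fderiv ℝ ζ x (EuclideanSpace.single i 1) := by
      have h2 := ((hζ.differentiable two_ne_zero x).hasFDerivAt.pow 2)
      have h3 : fderiv ℝ η x = _ := h2.fderiv
      rw [h3]
      simp
    rw [hηi]
    have h2 := (hρ _ (hball x hxO) (fderiv ℝ v x (EuclideanSpace.single i 1)))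
    change |fderiv ℝ H (χ (u x)) (v x) _ _| ≤ H (χ (u x)) _ _ at h2
    -- the cross term `2 ζ ∂ᵢζ H(v, ∂ᵢv)` is absorbed by expanding the square of `½ ζ ∂ᵢv + 2 ∂ᵢζ v`
    have h3 := pullbackMetric_self_nonneg h ψ (χ (u x))
      ((1 / 2 * ζ x) • fderiv ℝ v x (EuclideanSpace.single i 1) +
        (2 * fderiv ℝ ζ x (EuclideanSpace.single i 1)) • v x)
    rw [← hH] at h3
    simp only [map_add, map_smul, add_apply, smul_apply, smul_eq_mul] at h3 ⊢
    rw [pullbackMetric_symm h ψ (χ (u x)) (fderiv ℝ v x (EuclideanSpace.single i 1)) (v x),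
      ← hH] at h3
    have h4 := mul_le_mul_of_nonneg_left (neg_le_of_abs_le h2) (sq_nonneg (ζ x))
    simp only [hη]
    linarith
  have hHvc : ContinuousOn (fun x ↦ H (χ (u x)) (v x) (v x)) (tsupport ζ) := by
    have h1 : ContinuousOn v (tsupport ζ) := hvs.continuousOn.mono hζO
    have h2 : ContinuousOn (fun x ↦ χ (u x)) (tsupport ζ) := by
      refine (h1.add (continuousOn_const (c := c))).congr fun x _ ↦ ?_
      simp [hv]
    exact ((hHs.continuousOn.comp h2 fun x hx ↦ χ.map_source (hsource x (hζO hx))).clm_apply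
      h1).clm_apply h1
  have hζd := hζ.continuous_fderiv two_ne_zero
  have hζc := hζ.continuous
  have hec := he.continuous
  have hI1 : IntegrableOn (fun x ↦ derivWithin F (Ici 0) (energyDensity h u x) *
      (η x * energyDensity h u x)) (tsupport ζ) :=
    (Continuous.continuousOn (by fun_prop)).integrableOn_compact hc
  have hI2 : IntegrableOn (fun x ↦ derivWithin F (Ici 0) (energyDensity h u x) *
      ((∑ i, fderiv ℝ ζ x (EuclideanSpace.single i 1) ^ 2) * H (χ (u x)) (v x) (v x)))
      (tsupport ζ) := by
    refine ContinuousOn.integrableOn_compact hc (hfc.continuousOn.mul (ContinuousOn.mul ?_ hHvc))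
    exact Continuous.continuousOn (by fun_prop)
  have hfin := setIntegral_mono_on ((hI1.const_mul (1 / 2)).sub (hI2.const_mul 4)) hDi
    (isClosed_tsupport ζ).measurableSet fun x hx ↦ by
      have h1 := mul_le_mul_of_nonneg_left (hlow x hx)
        (hF.derivWithin_nonneg (energyDensity_nonneg h u x))
      refine le_trans (le_of_eq ?_) h1
      simp only [Pi.sub_apply]
      ring
  rw [hvar] at hfin
  simp only [Pi.sub_apply] at hfin
  rw [integral_sub (hI1.const_mul (1 / 2)) (hI2.const_mul 4), integral_const_mul,
    integral_const_mul] at hfin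
  linarith

end

/-! ### Decay of the energy on annuli -/

/-- A cutoff on `ℝ` equal to `1` on `[1, 2]` and supported in `[1 / 2, 4]`. -/
theorem exists_smooth_annular_cutoff : ∃ κ : ℝ → ℝ, ContDiff ℝ 2 κ ∧ (∀ s, 0 ≤ κ s) ∧
    (∀ s, κ s ≤ 1) ∧ (∀ s, 1 ≤ s → s ≤ 2 → κ s = 1) ∧ (∀ s, κ s ≠ 0 → 1 / 2 ≤ s ∧ s ≤ 4) ∧
    ∃ C, 0 < C ∧ ∀ s, |deriv κ s| ≤ C := by
  obtain ⟨θ, hθ, hθ0, hθle, hθ1, hθ2, -, C, hC0, hC⟩ := exists_smooth_cutoff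
  have hd : ∀ s, HasDerivAt (fun s ↦ (1 - θ (2 * s)) * θ (s / 2))
      (-(deriv θ (2 * s) * 2) * θ (s / 2) + (1 - θ (2 * s)) * (deriv θ (s / 2) * (1 / 2))) s := by
    intro s
    have h1 : HasDerivAt (fun s : ℝ ↦ 2 * s) 2 s := by simpa using (hasDerivAt_id s).const_mul 2
    have h2 : HasDerivAt (fun s : ℝ ↦ s / 2) (1 / 2) s := (hasDerivAt_id s).div_const 2
    have h3 : ∀ t, HasDerivAt θ (deriv θ t) t := fun t ↦
      (hθ.differentiable two_ne_zero t).hasDerivAt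
    exact (((h3 _).comp s h1).const_sub 1).mul ((h3 _).comp s h2)
  refine ⟨fun s ↦ (1 - θ (2 * s)) * θ (s / 2), by fun_prop,
    fun s ↦ mul_nonneg (sub_nonneg.2 (hθle _)) (hθ0 _),
    fun s ↦ mul_le_one₀ (by linarith [hθ0 (2 * s)]) (hθ0 _) (hθle _), fun s h1 h2 ↦ ?_,
    fun s hs ↦ ⟨?_, ?_⟩, 3 * C, by positivity, fun s ↦ ?_⟩
  · change (1 - θ (2 * s)) * θ (s / 2) = 1
    rw [hθ2 (2 * s) (by linarith), hθ1 (s / 2) (by linarith)]; norm_num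
  · by_contra hcon
    exact hs (by simp [hθ1 (2 * s) (by linarith)])
  · by_contra hcon
    exact hs (by simp [hθ2 (s / 2) (by linarith)])
  · rw [(hd s).deriv]
    have h1 := abs_le.1 (hC (2 * s))
    have h2 := hC (s / 2)
    have h3 : |-(deriv θ (2 * s) * 2) * θ (s / 2)| ≤ 2 * C := by
      rw [abs_mul, abs_neg, abs_mul, abs_two, abs_of_nonneg (hθ0 _)]
      calc |deriv θ (2 * s)| * 2 * θ (s / 2) ≤ C * 2 * 1 := by gcongr; exacts [hθ0 _, hC _, hθle _]
        _ = 2 * C := by ring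
    have h4 : |(1 - θ (2 * s)) * (deriv θ (s / 2) * (1 / 2))| ≤ C := by
      rw [abs_mul, abs_mul, abs_of_nonneg (sub_nonneg.2 (hθle _))]
      calc (1 - θ (2 * s)) * (|deriv θ (s / 2)| * |(1 / 2 : ℝ)|) ≤ 1 * (C * 1) := by
            gcongr
            · linarith [hθ0 (2 * s)]
            · rw [abs_of_pos] <;> norm_num
        _ = C := by ring
    exact (abs_add_le _ _).trans (by linarith)

section

variable {m n : ℕ} {N : Type*} [TopologicalSpace N]
  [ChartedSpace (EuclideanSpace ℝ (Fin n)) N] [IsManifold (𝓡 n) ∞ N]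
  {h : ContMDiffRiemannianMetric (𝓡 n) ∞ (EuclideanSpace ℝ (Fin n))
      (fun y : N ↦ TangentSpace (𝓡 n) y)}

theorem sum_sq_fderiv_comp_norm_sq {κ : ℝ → ℝ} {κ' r : ℝ} {x : EuclideanSpace ℝ (Fin m)}
    (hκ : HasDerivAt κ κ' (‖x‖ ^ 2 / r)) :
    ∑ i, fderiv ℝ (fun x : EuclideanSpace ℝ (Fin m) ↦ κ (‖x‖ ^ 2 / r)) x
      (EuclideanSpace.single i 1) ^ 2 = 4 * κ' ^ 2 / r ^ 2 * ‖x‖ ^ 2 := by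
  have h1 : HasFDerivAt (fun x : EuclideanSpace ℝ (Fin m) ↦ ‖x‖ ^ 2 / r)
      (r⁻¹ • (2 • innerSL ℝ x)) x := by
    simpa only [div_eq_mul_inv] using (hasStrictFDerivAt_norm_sq x).hasFDerivAt.mul_const r⁻¹
  have h2 : fderiv ℝ (fun x : EuclideanSpace ℝ (Fin m) ↦ κ (‖x‖ ^ 2 / r)) x = _ :=
    (hκ.comp_hasFDerivAt x h1).fderiv
  rw [h2, EuclideanSpace.real_norm_sq_eq, Finset.mul_sum]
  refine Finset.sum_congr rfl fun i _ ↦ ?_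
  simp only [smul_apply, innerSL_apply_apply, smul_eq_mul, EuclideanSpace.inner_single_right]
  simp
  ring

/-- The `F`-energy of `u` on the annuli `R² ≤ |x|² ≤ 2 R²` is `o(R^(m - 2))`: in the Caccioppoli
inequality with a cutoff of scale `R`, the gradient contributes `R^(-2)`, the volume `R^m`, and the
coordinates of `u` tend to `0`. -/
theorem IsFHarmonic.exists_annulus_integral_le {F : ℝ → ℝ} (hF : IsProfile F)
    (hl : 0 < lowerDegree F)
    {u : EuclideanSpace ℝ (Fin m) → N} (hu : ContMDiff (𝓡 m) (𝓡 n) 2 u)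
    (hharm : IsFHarmonic F h u)
    (hbdd : ∃ C : ℝ, ∀ x, derivWithin F (Ici 0) (energyDensity h u x) ≤ C) {p₀ : N}
    (hlim : Tendsto u (Bornology.cobounded (EuclideanSpace ℝ (Fin m))) (𝓝 p₀))
    {ε : ℝ} (hε : 0 < ε) :
    ∃ R₁ : ℝ, 0 < R₁ ∧ ∀ R, R₁ ≤ R →
      ∫ x in {x : EuclideanSpace ℝ (Fin m) | R ^ 2 ≤ ‖x‖ ^ 2 ∧ ‖x‖ ^ 2 ≤ 2 * R ^ 2},
        F (energyDensity h u x) ≤ ε * (R ^ m / R ^ 2) := by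
  obtain ⟨hFc, hfc⟩ := continuous_profile_energyDensity (h := h) hF hu
  have he : ContDiffOn ℝ 1 (energyDensity h u) univ :=
    contDiffOn_energyDensity isOpen_univ hu.contMDiffOn
  rw [contDiffOn_univ] at he
  have hec := he.continuous
  obtain ⟨l, hl0, hlF⟩ := hF.exists_mul_le_mul_derivWithin hl
  obtain ⟨κ, hκ, hκ0, hκ1, hκA, hκs, C, hC0, hC⟩ := exists_smooth_annular_cutoff
  obtain ⟨C₁', hC₁'⟩ := hbdd
  obtain ⟨C₁, hC₁0, hC₁⟩ : ∃ C₁ : ℝ, 0 < C₁ ∧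
      ∀ x, derivWithin F (Ici 0) (energyDensity h u x) ≤ C₁ :=
    ⟨max C₁' 1, by simp, fun x ↦ (hC₁' x).trans (le_max_left _ _)⟩
  set χ := extChartAt (𝓡 n) p₀ with hχ
  have hψs : ContMDiffOn (𝓡 n) (𝓡 n) 2 χ.symm χ.target :=
    (contMDiffOn_extChartAt_symm (n := ∞) p₀).of_le ENat.LEInfty.out
  obtain ⟨ρ, C₂, hρ0, hC₂0, hρT, hρ⟩ := exists_radius_abs_fderiv_le (isOpen_extChartAt_target p₀)
    (contDiffOn_pullbackMetric h (isOpen_extChartAt_target p₀) hψs) (mem_extChartAt_target p₀)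
    (fun a ha ↦ pullbackMetric_extChartAt_symm_pos (h := h) p₀ ha)
  set V : ℝ := volume.real (Metric.closedBall (0 : EuclideanSpace ℝ (Fin m)) 1) with hV
  set M : ℝ := 8 * (C₁ * (16 * C ^ 2 * C₂) * (2 ^ m * V)) / l with hM
  have hM0 : 0 ≤ M := by positivity
  obtain ⟨δ, hδ0, hδρ, hδM⟩ : ∃ δ, 0 < δ ∧ δ ≤ ρ ∧ M * δ ^ 2 ≤ ε := by
    refine ⟨min ρ (min 1 (ε / (M + 1))), by positivity, min_le_left _ _, ?_⟩
    set δ := min ρ (min 1 (ε / (M + 1)))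
    have h0 : 0 < δ := by positivity
    have h1 : δ ≤ 1 := (min_le_right _ _).trans (min_le_left _ _)
    have h2 : δ ≤ ε / (M + 1) := (min_le_right _ _).trans (min_le_right _ _)
    rw [le_div_iff₀ (by positivity)] at h2
    nlinarith [mul_le_mul_of_nonneg_left h1 h0.le]
  have hnear : ∀ᶠ p in 𝓝 p₀, p ∈ χ.source ∧ χ p ∈ Metric.ball (χ p₀) δ :=
    (show ∀ᶠ p in 𝓝 p₀, p ∈ χ.source from extChartAt_source_mem_nhds p₀).and
      ((continuousAt_extChartAt (I := 𝓡 n) p₀).eventually (Metric.ball_mem_nhds _ hδ0))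
  obtain ⟨r, -, hr⟩ := (Filter.hasBasis_cobounded_norm.eventually_iff).1 (hlim.eventually hnear)
  -- for `R ≥ 2 * r` the support `R² / 2 ≤ |x|² ≤ 4 R²` of the cutoff lies in `|x| > r`
  refine ⟨2 * max r 1, by positivity, fun R hR ↦ ?_⟩
  have hR1 : 2 ≤ R := le_trans (by linarith [le_max_right r 1]) hR
  have hRr : 2 * r ≤ R := le_trans (by linarith [le_max_left r 1]) hR
  have hR0 : 0 < R := by linarith
  have hR2 : 0 < R ^ 2 := by positivity
  set O : Set (EuclideanSpace ℝ (Fin m)) := {x | max r 0 < ‖x‖} with hO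
  have hOo : IsOpen O := isOpen_lt continuous_const continuous_norm
  have hOr : ∀ x ∈ O, u x ∈ χ.source ∧ χ (u x) ∈ Metric.ball (χ p₀) δ := fun x hx ↦
    hr ((le_max_left r 0).trans (le_of_lt hx))
  set ζ : EuclideanSpace ℝ (Fin m) → ℝ := fun x ↦ κ (‖x‖ ^ 2 / R ^ 2) with hζdef
  have hζ : ContDiff ℝ 2 ζ := hκ.comp ((contDiff_norm_sq ℝ).div_const _)
  set A' : Set (EuclideanSpace ℝ (Fin m)) :=
    {x | R ^ 2 / 2 ≤ ‖x‖ ^ 2 ∧ ‖x‖ ^ 2 ≤ 4 * R ^ 2} with hA'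
  have hA'c : IsCompact A' := isCompact_annulus m _ _
  have hζA' : tsupport ζ ⊆ A' := by
    refine closure_minimal (fun x hx ↦ ?_) hA'c.isClosed
    have h1 := hκs _ hx
    rw [le_div_iff₀ hR2, div_le_iff₀ hR2] at h1
    exact ⟨by linarith [h1.1], h1.2⟩
  have hζc : HasCompactSupport ζ := hA'c.of_isClosed_subset (isClosed_tsupport _) hζA'
  have hA'O : A' ⊆ O := by
    intro x hx
    by_contra hcon
    rw [hO, mem_ofPred_eq, not_lt] at hcon
    have h1 : ‖x‖ ≤ R / 2 := hcon.trans (max_le (by linarith) (by linarith))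
    have h2 : ‖x‖ ^ 2 ≤ (R / 2) ^ 2 := by gcongr
    nlinarith [hx.1]
  have hA'ball : A' ⊆ Metric.closedBall 0 (2 * R) := by
    intro x hx
    rw [mem_closedBall_zero_iff]
    refine abs_le_of_sq_le_sq' ?_ (by positivity) |>.2
    nlinarith [hx.2]
  have hcac := hharm.setIntegral_cutoff_le hF hu hρT (fun y hy a ↦ (hρ y hy a).1) hOo
    (fun x hx ↦ (hOr x hx).1) (fun x hx ↦ Metric.ball_subset_ball hδρ (hOr x hx).2) hζ
    (fun x ↦ hκ0 _) (fun x ↦ hκ1 _) hζc (hζA'.trans hA'O)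
  set A : Set (EuclideanSpace ℝ (Fin m)) := {x | R ^ 2 ≤ ‖x‖ ^ 2 ∧ ‖x‖ ^ 2 ≤ 2 * R ^ 2} with hA
  have hAc : IsCompact A := isCompact_annulus m _ _
  have hζone : ∀ x ∈ A, ζ x = 1 := fun x hx ↦
    hκA _ (by rw [le_div_iff₀ hR2]; linarith [hx.1]) (by rw [div_le_iff₀ hR2]; exact hx.2)
  have hAζ : A ⊆ tsupport ζ := fun x hx ↦ subset_tsupport _ (by simp [hζone x hx])
  have hf0 : ∀ x, 0 ≤ derivWithin F (Ici 0) (energyDensity h u x) := fun x ↦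
    hF.derivWithin_nonneg (energyDensity_nonneg h u x)
  have hIc : IntegrableOn (fun x ↦ derivWithin F (Ici 0) (energyDensity h u x) *
      (ζ x ^ 2 * energyDensity h u x)) (tsupport ζ) := by
    have := hζ.continuous
    exact (Continuous.continuousOn (by fun_prop)).integrableOn_compact hζc
  have hlower : l * ∫ x in A, F (energyDensity h u x) ≤
      ∫ x in tsupport ζ, derivWithin F (Ici 0) (energyDensity h u x) *
        (ζ x ^ 2 * energyDensity h u x) := by
    rw [← integral_const_mul]
    refine le_trans (setIntegral_mono_on
      ((continuous_const.mul hFc).continuousOn.integrableOn_compact hAc) (hIc.mono_set hAζ)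
      hAc.measurableSet fun x hx ↦ ?_)
      (setIntegral_mono_set hIc (.of_forall fun x ↦ ?_) hAζ.eventuallyLE)
    · rw [hζone x hx, one_pow, one_mul, mul_comm (derivWithin F (Ici 0) _)]
      exact hlF _ (energyDensity_nonneg h u x)
    · exact mul_nonneg (hf0 x) (mul_nonneg (sq_nonneg _) (energyDensity_nonneg h u x))
  have hvol : volume.real (tsupport ζ) ≤ 2 ^ m * V * R ^ m := by
    calc volume.real (tsupport ζ)
        ≤ volume.real (Metric.closedBall (0 : EuclideanSpace ℝ (Fin m)) (2 * R)) :=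
          measureReal_mono (hζA'.trans hA'ball) measure_closedBall_lt_top.ne
      _ = (2 * R) ^ m * V := by
          rw [Measure.addHaar_real_closedBall' _ _ (by positivity), finrank_euclideanSpace_fin]
      _ = _ := by ring
  have hupper : ∫ x in tsupport ζ, derivWithin F (Ici 0) (energyDensity h u x) *
        ((∑ i, fderiv ℝ ζ x (EuclideanSpace.single i 1) ^ 2) *
          pullbackMetric h χ.symm (χ (u x)) (χ (u x) - χ p₀) (χ (u x) - χ p₀)) ≤
      C₁ * (16 * C ^ 2 / R ^ 2 * (C₂ * δ ^ 2)) * volume.real (tsupport ζ) := by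
    refine (le_abs_self _).trans ?_
    rw [← Real.norm_eq_abs]
    refine norm_setIntegral_le_of_norm_le_const hζc.measure_lt_top fun x hx ↦ ?_
    have hxA' := hζA' hx
    have hxO := hA'O hxA'
    have h1 : ∑ i, fderiv ℝ ζ x (EuclideanSpace.single i 1) ^ 2 ≤ 16 * C ^ 2 / R ^ 2 := by
      rw [sum_sq_fderiv_comp_norm_sq (hκ.differentiable two_ne_zero _).hasDerivAt]
      calc 4 * deriv κ (‖x‖ ^ 2 / R ^ 2) ^ 2 / (R ^ 2) ^ 2 * ‖x‖ ^ 2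
          ≤ 4 * C ^ 2 / (R ^ 2) ^ 2 * (4 * R ^ 2) := by
            have hsq : deriv κ (‖x‖ ^ 2 / R ^ 2) ^ 2 ≤ C ^ 2 :=
              sq_le_sq' (neg_le_of_abs_le (hC _)) (le_of_abs_le (hC _))
            exact mul_le_mul (div_le_div_of_nonneg_right (by linarith) (by positivity)) hxA'.2
              (by positivity) (by positivity)
        _ = 16 * C ^ 2 / R ^ 2 := by field_simp; ring
    have h2 : pullbackMetric h χ.symm (χ (u x)) (χ (u x) - χ p₀) (χ (u x) - χ p₀) ≤
        C₂ * δ ^ 2 := by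
      refine ((hρ _ (Metric.ball_subset_ball hδρ (hOr x hxO).2) _).2).trans ?_
      gcongr
      rw [← dist_eq_norm]
      exact (Metric.mem_ball.1 (hOr x hxO).2).le
    have h3 := pullbackMetric_self_nonneg h χ.symm (χ (u x)) (χ (u x) - χ p₀)
    have h4 : 0 ≤ ∑ i, fderiv ℝ ζ x (EuclideanSpace.single i 1) ^ 2 :=
      Finset.sum_nonneg fun i _ ↦ sq_nonneg _
    rw [Real.norm_of_nonneg (mul_nonneg (hf0 x) (mul_nonneg h4 h3))]
    gcongr
    exact hC₁ x
  have hfin : l * ∫ x in A, F (energyDensity h u x) ≤ l * (ε * (R ^ m / R ^ 2)) := by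
    calc l * ∫ x in A, F (energyDensity h u x)
        ≤ 8 * (C₁ * (16 * C ^ 2 / R ^ 2 * (C₂ * δ ^ 2)) * volume.real (tsupport ζ)) :=
          hlower.trans (hcac.trans (by gcongr))
      _ ≤ 8 * (C₁ * (16 * C ^ 2 / R ^ 2 * (C₂ * δ ^ 2)) * (2 ^ m * V * R ^ m)) := by gcongr
      _ = l * (M * δ ^ 2 * (R ^ m / R ^ 2)) := by rw [hM]; field_simp
      _ ≤ l * (ε * (R ^ m / R ^ 2)) := by gcongr
  exact le_of_mul_le_mul_left hfin hl0

/-! ### Vanishing of the energy and constancy -/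

theorem mfderiv_eq_zero_of_energyDensity_eq_zero {u : EuclideanSpace ℝ (Fin m) → N}
    {x : EuclideanSpace ℝ (Fin m)} (hx : energyDensity h u x = 0) :
    mfderiv (𝓡 m) (𝓡 n) u x = 0 := by
  rw [energyDensity_eq, div_eq_zero_iff, or_iff_left two_ne_zero,
    Finset.sum_eq_zero_iff_of_nonneg fun i _ ↦ pullbackMetric_self_nonneg h u x _] at hx
  have h1 : ∀ i, mfderiv (𝓡 m) (𝓡 n) u x (EuclideanSpace.single i (1 : ℝ)) = 0 := by
    intro i
    by_contra hne
    exact (h.pos _ _ hne).ne' (hx i (Finset.mem_univ i))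
  ext1 a
  have h2 := congrArg (mfderiv (𝓡 m) (𝓡 n) u x) (sum_coord_smul_single a)
  refine h2.symm.trans ?_
  refine (map_sum (mfderiv (𝓡 m) (𝓡 n) u x) _ _).trans (Finset.sum_eq_zero fun i _ ↦ ?_)
  exact (map_smul (mfderiv (𝓡 m) (𝓡 n) u x) _ _).trans (by rw [h1 i]; exact smul_zero _)

theorem exists_forall_eq_of_mfderiv_eq_zero {u : EuclideanSpace ℝ (Fin m) → N}
    (hu : MDifferentiable (𝓡 m) (𝓡 n) u) (hd : ∀ x, mfderiv (𝓡 m) (𝓡 n) u x = 0) :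
    ∃ q, ∀ x, u x = q := by
  have hloc : IsLocallyConstant u := by
    rw [IsLocallyConstant.iff_eventually_eq]
    intro x₀
    set χ := extChartAt (𝓡 n) (u x₀) with hχ
    obtain ⟨r, hr, hball⟩ := Metric.mem_nhds_iff.1
      (hu.continuous.continuousAt.preimage_mem_nhds (extChartAt_source_mem_nhds (I := 𝓡 n) (u x₀)))
    have hfd : ∀ x ∈ Metric.ball x₀ r, HasFDerivAt (fun x ↦ χ (u x))
        (0 : EuclideanSpace ℝ (Fin m) →L[ℝ] EuclideanSpace ℝ (Fin n)) x := by
      intro x hx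
      have h1 : MDifferentiableAt (𝓡 n) (𝓡 n) χ (u x) :=
        mdifferentiableAt_extChartAt (by simpa [extChartAt_source] using hball hx)
      have h2 := h1.hasMFDerivAt.comp x (hu x).hasMFDerivAt
      rw [hd x] at h2
      have h3 := hasMFDerivAt_iff_hasFDerivAt.1 h2
      exact h3.congr_fderiv (ContinuousLinearMap.comp_zero _)
    filter_upwards [Metric.ball_mem_nhds x₀ hr] with x hx
    have h4 := (convex_ball x₀ r).is_const_of_fderivWithin_eq_zero (𝕜 := ℝ)
      (fun y hy ↦ (hfd y hy).differentiableAt.differentiableWithinAt)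
      (fun y hy ↦ by
        rw [fderivWithin_of_isOpen Metric.isOpen_ball hy, (hfd y hy).fderiv]) hx
      (Metric.mem_ball_self hr)
    exact χ.injOn (hball hx) (hball (Metric.mem_ball_self hr)) h4
  exact ⟨u 0, fun x ↦ hloc.apply_eq_of_preconnectedSpace x 0⟩

theorem IsFHarmonic.energyDensity_eq_zero (hm : 2 < m) {F : ℝ → ℝ} (hF : IsProfile F)
    (hl : 0 < lowerDegree F) (hd : upperDegree F ≤ 1)
    {u : EuclideanSpace ℝ (Fin m) → N} (hu : ContMDiff (𝓡 m) (𝓡 n) 2 u)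
    (hharm : IsFHarmonic F h u)
    (hbdd : ∃ C : ℝ, ∀ x, derivWithin F (Ici 0) (energyDensity h u x) ≤ C) {p₀ : N}
    (hlim : Tendsto u (Bornology.cobounded (EuclideanSpace ℝ (Fin m))) (𝓝 p₀))
    (x₀ : EuclideanSpace ℝ (Fin m)) : energyDensity h u x₀ = 0 := by
  by_contra hne
  have hpos : 0 < energyDensity h u x₀ := lt_of_le_of_ne (energyDensity_nonneg h u x₀) (Ne.symm hne)
  obtain ⟨hFc, -⟩ := continuous_profile_energyDensity (h := h) hF hu
  obtain ⟨C, hC0, hC⟩ := hharm.exists_weighted_integral_le hm hF hd hu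
  set f : EuclideanSpace ℝ (Fin m) → ℝ := fun x ↦
    (1 + ‖x‖ ^ 2) ^ (-(((m : ℝ) - 2) / 2)) / (1 + ‖x‖ ^ 2) * F (energyDensity h u x) with hf
  have hp1 : ∀ x : EuclideanSpace ℝ (Fin m), (0 : ℝ) < 1 + ‖x‖ ^ 2 := fun x ↦ by positivity
  have hfc : Continuous f := by
    have h1 : Continuous fun x : EuclideanSpace ℝ (Fin m) ↦ 1 + ‖x‖ ^ 2 := by fun_prop
    exact ((h1.rpow_const fun x ↦ Or.inl (hp1 x).ne').div h1 fun x ↦ (hp1 x).ne').mul hFc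
  have hf0 : ∀ x, 0 ≤ f x := fun x ↦ mul_nonneg
    (div_pos (Real.rpow_pos_of_pos (hp1 x) _) (hp1 x)).le
    (hF.nonneg _ (energyDensity_nonneg h u x))
  have hfx₀ : 0 < f x₀ := mul_pos (div_pos (Real.rpow_pos_of_pos (hp1 x₀) _) (hp1 x₀)) (hF.pos hpos)
  have hfi : ∀ R, IntegrableOn f (Metric.closedBall 0 R) := fun R ↦
    hfc.continuousOn.integrableOn_compact (isCompact_closedBall _ _)
  set R₀ := ‖x₀‖ + 1 with hR₀
  set c₀ := ∫ x in Metric.closedBall (0 : EuclideanSpace ℝ (Fin m)) R₀, f x with hc₀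
  have hc₀pos : 0 < c₀ := by
    rw [hc₀, setIntegral_pos_iff_support_of_nonneg_ae (.of_forall hf0) (hfi R₀)]
    have hopen : IsOpen (Function.support f ∩ Metric.ball 0 R₀) :=
      hfc.isOpen_support.inter Metric.isOpen_ball
    have hmem : x₀ ∈ Function.support f ∩ Metric.ball 0 R₀ := ⟨hfx₀.ne', by simp [hR₀]⟩
    exact (hopen.measure_pos volume ⟨x₀, hmem⟩).trans_le
      (measure_mono (inter_subset_inter_right _ Metric.ball_subset_closedBall))
  obtain ⟨R₁, hR₁, hdecay⟩ := hharm.exists_annulus_integral_le hF hl hu hbdd hlim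
    (ε := c₀ / (2 * C)) (div_pos hc₀pos (mul_pos two_pos hC0))
  set R := max R₀ R₁ with hR
  have hRpos : 0 < R := hR₁.trans_le (le_max_right _ _)
  have hpow : (R ^ 2) ^ (-(((m : ℝ) - 2) / 2)) * (R ^ m / R ^ 2) = 1 := by
    have h1 : (R ^ 2) ^ (((m : ℝ) - 2) / 2) = R ^ m / R ^ 2 := by
      rw [← Real.rpow_natCast R 2, ← Real.rpow_mul hRpos.le, ← Real.rpow_natCast R m,
        ← Real.rpow_sub hRpos]
      congr 1
      push_cast
      ring
    rw [Real.rpow_neg (by positivity), h1]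
    exact inv_mul_cancel₀ (by positivity)
  have hle : c₀ ≤ c₀ / 2 := by
    calc c₀ ≤ ∫ x in Metric.closedBall (0 : EuclideanSpace ℝ (Fin m)) R, f x :=
          setIntegral_mono_set (hfi R) (.of_forall hf0)
            (Metric.closedBall_subset_closedBall (le_max_left _ _)).eventuallyLE
      _ ≤ C * (R ^ 2) ^ (-(((m : ℝ) - 2) / 2)) * (c₀ / (2 * C) * (R ^ m / R ^ 2)) := by
          refine (hC R hRpos).trans ?_
          gcongr
          exact hdecay R (le_max_right _ _)
      _ = C * (c₀ / (2 * C)) * ((R ^ 2) ^ (-(((m : ℝ) - 2) / 2)) * (R ^ m / R ^ 2)) := by ring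
      _ = c₀ / 2 := by rw [hpow]; field_simp
  linarith

end

end FHarmonic

theorem corollary5p3 {m n : ℕ} (hm : 2 < m)
    {N : Type*} [TopologicalSpace N] [T2Space N]
    [ChartedSpace (EuclideanSpace ℝ (Fin n)) N] [IsManifold (𝓡 n) ∞ N]
    (h : ContMDiffRiemannianMetric (𝓡 n) ∞ (EuclideanSpace ℝ (Fin n))
      (fun y : N ↦ TangentSpace (𝓡 n) y))
    (F : ℝ → ℝ) (hF : FHarmonic.IsProfile F)
    (hl : 0 < FHarmonic.lowerDegree F) (hd : FHarmonic.upperDegree F ≤ 1)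
    (u : EuclideanSpace ℝ (Fin m) → N)
    (hu : ContMDiff (𝓡 m) (𝓡 n) 2 u)
    (hharm : FHarmonic.IsFHarmonic F h u)
    (hbdd : ∃ C : ℝ, ∀ x, derivWithin F (Ici 0) (FHarmonic.energyDensity h u x) ≤ C)
    (p₀ : N) (hlim : Tendsto u (Bornology.cobounded (EuclideanSpace ℝ (Fin m))) (𝓝 p₀)) :
    ∃ q : N, ∀ x, u x = q :=
  FHarmonic.exists_forall_eq_of_mfderiv_eq_zero (hu.mdifferentiable two_ne_zero) fun x ↦
    FHarmonic.mfderiv_eq_zero_of_energyDensity_eq_zero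
      (hharm.energyDensity_eq_zero hm hF hl hd hu hbdd hlim x)
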